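/- Let $q\in L^2_{\mathbb R}[0,\pi]$ and $\alpha,\beta\in(0,\pi)$. Let $\mu_0<\mu_1<\mu_2<\cdots$ be the eigenvalues of the Sturm–Liouville problem $$-y''+q(x)y=\mu y \ \text{ on } (0,\pi),\qquad y(0)\cos\alpha+y'(0)\sin\alpha=0,\qquad y(\pi)\cos\beta+y'(\pi)\sin\beta=0 .$$ For $\mu\in\mathbb C$ let $\varphi(\cdot,\mu)$ and $\psi(\cdot,\mu)$ be the solutions of $-y''+qy=\mu y$ on $[0,\pi]$ with $\varphi(0,\mu)=\sin\alpha$, $\varphi'(0,\mu)=-\cos\alpha$ and $\psi(\pi,\mu)=\sin\beta$, $\psi'(\pi,\mu)=-\cos\beta$. Put $\tilde\varphi=\varphi/\sin\alpha$, $\tilde\psi=\psi/\sin\beta$, and define the norming constants $$\tilde a_n=\int_0^\pi|\tilde\varphi(x,\mu_n)|^2\,dx,\qquad \tilde b_n=\int_0^\pi|\tilde\psi(x,\mu_n)|^2\,dx,\qquad n=0,1,2,\dots$$ Then both of the following series converge, and $$\frac1{\tilde a_0}-\frac1\pi+\sum_{n=1}^\infty\Big(\frac1{\tilde a_n}-\frac2\pi\Big)=\cot\alpha,\qquad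 \frac1{\tilde b_0}-\frac1\pi+\sum_{n=1}^\infty\Big(\frac1{\tilde b_n}-\frac2\pi\Big)=-\cot\beta .$$ Here solutions are understood in the usual sense: $y$ is differentiable on $[0,\pi]$ with $y'$ absolutely continuous, and the equation holds almost everywhere. -/

import Mathlib

open MeasureTheory Set Filter Topology

noncomputable section

namespace SturmLiouville

/-- The derivative `y'` of a function on the interval `[0, π]` (one-sided at the endpoints). -/
def D (y : ℝ → ℂ) : ℝ → ℂ := derivWithin y (Icc 0 Real.pi)

/-- `y` is a (Carathéodory) solution of `-y'' + q y = μ y` on `[0, π]`: `y` is differentiable,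
`y'` is absolutely continuous, and the equation holds almost everywhere. -/
structure IsSolution (q : ℝ → ℝ) (μ : ℂ) (y : ℝ → ℂ) : Prop where
  differentiableOn : DifferentiableOn ℝ y (Icc 0 Real.pi)
  absolutelyContinuous : AbsolutelyContinuousOnInterval (D y) 0 Real.pi
  equation : ∀ᵐ x ∂(volume.restrict (Ioo 0 Real.pi)),
    ∃ y'' : ℂ, HasDerivAt (D y) y'' x ∧ -y'' + (q x : ℂ) * y x = μ * y x

/-- `μ` is an eigenvalue of the problem `L(q, α, β)`: there is a solution, not identically zero
on `[0, π]`, that satisfies both boundary conditions. -/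
def IsEigenvalue (q : ℝ → ℝ) (α β : ℝ) (μ : ℂ) : Prop :=
  ∃ y : ℝ → ℂ, IsSolution q μ y ∧ (∃ x ∈ Icc 0 Real.pi, y x ≠ 0) ∧
    y 0 * (Real.cos α : ℂ) + D y 0 * (Real.sin α : ℂ) = 0 ∧
    y Real.pi * (Real.cos β : ℂ) + D y Real.pi * (Real.sin β : ℂ) = 0

/-- `μ 0 < μ 1 < ⋯` is the list of all eigenvalues of `L(q, α, β)`. -/
def IsEigenvalueSequence (q : ℝ → ℝ) (α β : ℝ) (μ : ℕ → ℝ) : Prop :=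
  StrictMono μ ∧ ∀ z : ℂ, IsEigenvalue q α β z ↔ ∃ n, (μ n : ℂ) = z

/-- The eigenvalues `μ_n(q, α, β)`, `n = 0, 1, 2, …`, in increasing order. A strictly increasing
sequence is determined by its range, so there is at most one sequence to choose; it exists because
the spectrum is real, discrete, bounded below and infinite. -/
def eigenvalue (q : ℝ → ℝ) (α β : ℝ) : ℕ → ℝ :=
  Classical.epsilon (IsEigenvalueSequence q α β)

/-- The solution of `-y'' + q y = μ y` on `[0, π]` with `y(x₀) = c` and `y'(x₀) = d`, where
`x₀ ∈ [0, π]`. It exists and its values on `[0, π]` are unique for integrable `q`. -/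
def solutionIVP (q : ℝ → ℝ) (μ : ℂ) (x₀ : ℝ) (c d : ℂ) : ℝ → ℂ :=
  Classical.epsilon fun y : ℝ → ℂ => IsSolution q μ y ∧ y x₀ = c ∧ D y x₀ = d

/-- `φ(x, μ, α, q)`: the solution with `φ(0) = sin α`, `φ'(0) = -cos α`. -/
def phi (q : ℝ → ℝ) (α : ℝ) (μ : ℂ) : ℝ → ℂ :=
  solutionIVP q μ 0 (Real.sin α : ℂ) (-(Real.cos α : ℂ))

/-- `ψ(x, μ, β, q)`: the solution with `ψ(π) = sin β`, `ψ'(π) = -cos β`. -/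
def psi (q : ℝ → ℝ) (β : ℝ) (μ : ℂ) : ℝ → ℂ :=
  solutionIVP q μ Real.pi (Real.sin β : ℂ) (-(Real.cos β : ℂ))

/-- `φ̃ = φ / sin α`. -/
def phiTilde (q : ℝ → ℝ) (α : ℝ) (μ : ℂ) (x : ℝ) : ℂ := phi q α μ x / (Real.sin α : ℂ)

/-- `ψ̃ = ψ / sin β`. -/
def psiTilde (q : ℝ → ℝ) (β : ℝ) (μ : ℂ) (x : ℝ) : ℂ := psi q β μ x / (Real.sin β : ℂ)

/-- The norming constant `ã_n(q, α, β) = ∫₀^π |φ̃(x, μ_n)|² dx`. -/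
def aTilde (q : ℝ → ℝ) (α β : ℝ) (n : ℕ) : ℝ :=
  ∫ x in (0 : ℝ)..Real.pi, ‖phiTilde q α (eigenvalue q α β n : ℂ) x‖ ^ 2

/-- The norming constant `b̃_n(q, α, β) = ∫₀^π |ψ̃(x, μ_n)|² dx`. -/
def bTilde (q : ℝ → ℝ) (α β : ℝ) (n : ℕ) : ℝ :=
  ∫ x in (0 : ℝ)..Real.pi, ‖psiTilde q β (eigenvalue q α β n : ℂ) x‖ ^ 2

end SturmLiouville

end

/-! Put h = -cot α, H = cot β, and let y_n be the eigenfunction for μ_n with y_n(0) = 1, y_n'(0) =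
h, so that ã_n = ∫ y_n². The formula comes from computing the Green function at spectral parameter
-k², with both arguments at 0, in two ways. The eigenfunction expansion gives ∑ 1/(ã_n (μ_n + k²)).
The solution u that satisfies the condition at π gives 1/(h - u'(0)/u(0)), where -u'(0)/u(0) = k +
o(1) as k → ∞. Subtract the same identity for q = 0, h = H = 0, whose eigenvalues are n² and whose
weights are 1/π and 2/π, and multiply by k². The closed forms tend to -h = cot α, while the series
tends term by term to the regularized sum of 1/ã_n. The formula for b̃_n is the same statement for
the reflected potential q(π - x), whose slope at the left end is cot β and whose eigenvalues are
unchanged.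

Three ingredients carry this. Prüfer angles enumerate the eigenvalues and place μ_n between (n -
1/2)² and (n + 1/2)² for large n (`SolFamily.exists_eigenvalues`). An integral identity
(`RealSol.integral_sq`) shows that ã_n - π/2 is bounded by a sine coefficient of (π - x) q over n,
plus O(1/n²); for q in L² this is summable and justifies exchanging limit and sum. Finally,
eigenfunctions within O(1/n) of cos(nx) form a complete orthogonal system (`eq_zero_of_orthogonal`),
so the Green function expansion holds pointwise, even at 0 (`hasSum_expansion`,
`EigenSystem.hasSum_green`). The two evaluations meet in `hasSum_of_hasSum_green`. -/

namespace SturmLiouville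

open Real

/-! ### Calculus of absolutely continuous functions on [0, π] -/

/-- `f` is absolutely continuous on `[0, π]` with almost everywhere derivative `f'`. -/
structure ACD (f f' : ℝ → ℝ) : Prop where
  ac : AbsolutelyContinuousOnInterval f 0 π
  hasDerivAt_ae : ∀ᵐ x, x ∈ Icc 0 π → HasDerivAt f (f' x) x

theorem uIcc_zero_pi : uIcc 0 π = Icc 0 π := uIcc_of_le pi_pos.le

theorem absolutelyContinuousOnInterval_congr {X : Type*} [PseudoMetricSpace X] {f g : ℝ → X}
    {a b : ℝ} (hf : AbsolutelyContinuousOnInterval f a b) (h : ∀ x ∈ uIcc a b, f x = g x) :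
    AbsolutelyContinuousOnInterval g a b := by
  rw [absolutelyContinuousOnInterval_iff] at hf ⊢
  intro ε hε
  obtain ⟨δ, hδ, H⟩ := hf ε hε
  refine ⟨δ, hδ, fun E hE hlt => ?_⟩
  convert H E hE hlt using 1
  refine Finset.sum_congr rfl fun i hi => ?_
  rw [h _ (hE.1 i hi).1, h _ (hE.1 i hi).2]

theorem absolutelyContinuousOnInterval_lipschitz_comp {X Y : Type*} [PseudoMetricSpace X]
    [PseudoMetricSpace Y] {f : ℝ → X} {F : X → Y} {s : Set X} {K : NNReal} {a b : ℝ}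
    (hF : LipschitzOnWith K F s)
    (hf : AbsolutelyContinuousOnInterval f a b) (hs : ∀ x ∈ uIcc a b, f x ∈ s) :
    AbsolutelyContinuousOnInterval (fun x => F (f x)) a b := by
  rw [absolutelyContinuousOnInterval_iff] at hf ⊢
  intro ε hε
  obtain ⟨δ, hδ, H⟩ := hf (ε / (K + 1)) (by positivity)
  refine ⟨δ, hδ, fun E hE hlt => ?_⟩
  have h1 := H E hE hlt
  rw [lt_div_iff₀ (by positivity)] at h1
  refine lt_of_le_of_lt ?_ h1
  rw [Finset.sum_mul]
  refine Finset.sum_le_sum fun i hi => ?_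
  refine (hF.dist_le_mul _ (hs _ (hE.1 i hi).1) _ (hs _ (hE.1 i hi).2)).trans ?_
  rw [mul_comm]
  gcongr
  linarith

namespace ACD

variable {f f' g g' : ℝ → ℝ}

theorem continuousOn (hf : ACD f f') : ContinuousOn f (Icc 0 π) := by
  simpa [uIcc_zero_pi] using hf.ac.continuousOn

theorem congr_deriv (hf : ACD f f') (h : ∀ x ∈ Icc 0 π, f' x = g' x) : ACD f g' :=
  ⟨hf.ac, by filter_upwards [hf.hasDerivAt_ae] with x hx hx'; rw [← h x hx']; exact hx hx'⟩

theorem add (hf : ACD f f') (hg : ACD g g') : ACD (fun x => f x + g x) fun x => f' x + g' x :=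
  ⟨hf.ac.add hg.ac, by
    filter_upwards [hf.hasDerivAt_ae, hg.hasDerivAt_ae] with x h1 h2 hx using (h1 hx).add (h2 hx)⟩

theorem sub (hf : ACD f f') (hg : ACD g g') : ACD (fun x => f x - g x) fun x => f' x - g' x :=
  ⟨hf.ac.sub hg.ac, by
    filter_upwards [hf.hasDerivAt_ae, hg.hasDerivAt_ae] with x h1 h2 hx using (h1 hx).sub (h2 hx)⟩

theorem mul (hf : ACD f f') (hg : ACD g g') :
    ACD (fun x => f x * g x) fun x => f' x * g x + f x * g' x :=
  ⟨hf.ac.mul hg.ac, by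
    filter_upwards [hf.hasDerivAt_ae, hg.hasDerivAt_ae] with x h1 h2 hx using (h1 hx).mul (h2 hx)⟩

theorem of_contDiff (hf : ContDiff ℝ 1 f) : ACD f (deriv f) :=
  ⟨hf.contDiffOn.absolutelyContinuousOnInterval,
    ae_of_all _ fun x _ => (hf.differentiable one_ne_zero x).hasDerivAt⟩

theorem of_hasDerivAt (hf : ContDiff ℝ 1 f) (h : ∀ x, HasDerivAt f (f' x) x) : ACD f f' :=
  (of_contDiff hf).congr_deriv fun x _ => (h x).deriv

protected theorem const (a : ℝ) : ACD (fun _ => a) fun _ => 0 :=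
  of_hasDerivAt contDiff_const fun x => hasDerivAt_const x a

protected theorem id : ACD (fun x => x) fun _ => 1 := of_hasDerivAt contDiff_id fun x => hasDerivAt_id x

theorem const_mul (a : ℝ) (hf : ACD f f') : ACD (fun x => a * f x) fun x => a * f' x :=
  ((ACD.const a).mul hf).congr_deriv fun x _ => by ring

theorem neg (hf : ACD f f') : ACD (fun x => -f x) fun x => -f' x :=
  ⟨hf.ac.neg, by filter_upwards [hf.hasDerivAt_ae] with x h1 hx using (h1 hx).neg⟩

/-- An absolutely continuous f is bounded on [0, π], and a C¹ function is Lipschitz on a bounded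
interval, which is all that the composition needs. -/
theorem comp {F F' : ℝ → ℝ} (hF : ContDiff ℝ 1 F) (hF' : ∀ x, HasDerivAt F (F' x) x)
    (hf : ACD f f') : ACD (fun x => F (f x)) fun x => F' (f x) * f' x := by
  obtain ⟨C, hC⟩ := hf.ac.exists_bound
  obtain ⟨K, hK⟩ := hF.contDiffOn.exists_lipschitzOnWith (s := Icc (-C) C) one_ne_zero
    (convex_Icc _ _) isCompact_Icc
  refine ⟨absolutelyContinuousOnInterval_lipschitz_comp hK hf.ac fun x hx =>
    abs_le.1 (hC x hx), ?_⟩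
  filter_upwards [hf.hasDerivAt_ae] with x h1 hx using (hF' _).comp x (h1 hx)

protected theorem sin (hf : ACD f f') : ACD (fun x => Real.sin (f x)) fun x => Real.cos (f x) * f' x :=
  comp Real.contDiff_sin Real.hasDerivAt_sin hf

protected theorem cos (hf : ACD f f') : ACD (fun x => Real.cos (f x)) fun x => -Real.sin (f x) * f' x :=
  comp Real.contDiff_cos Real.hasDerivAt_cos hf

protected theorem exp (hf : ACD f f') : ACD (fun x => Real.exp (f x)) fun x => Real.exp (f x) * f' x :=
  comp Real.contDiff_exp Real.hasDerivAt_exp hf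

theorem ae_deriv_eq (hf : ACD f f') : ∀ᵐ x, x ∈ Icc 0 π → deriv f x = f' x := by
  filter_upwards [hf.hasDerivAt_ae] with x h hx using (h hx).deriv

theorem intervalIntegrable (hf : ACD f f') : IntervalIntegrable f' volume 0 π := by
  refine hf.ac.intervalIntegrable_deriv.congr_ae ?_
  rw [uIoc_of_le pi_pos.le, Filter.EventuallyEq, ae_restrict_iff' measurableSet_Ioc]
  filter_upwards [hf.ae_deriv_eq] with x h hx using h (Ioc_subset_Icc_self hx)

theorem integral_eq_sub (hf : ACD f f') {x : ℝ} (hx : x ∈ Icc 0 π) :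
    ∫ t in (0 : ℝ)..x, f' t = f x - f 0 := by
  rw [← (hf.ac.mono (c := 0) (d := x) ?_).integral_deriv_eq_sub]
  · refine intervalIntegral.integral_congr_ae ?_
    filter_upwards [hf.ae_deriv_eq] with t h ht
    rw [uIoc_of_le hx.1] at ht
    exact (h ⟨ht.1.le, ht.2.trans hx.2⟩).symm
  · rw [uIcc_zero_pi, uIcc_of_le hx.1]; exact Icc_subset_Icc_right hx.2

theorem of_integral (h : IntervalIntegrable f' volume 0 π) :
    ACD (fun x => ∫ t in (0 : ℝ)..x, f' t) f' := by
  refine ⟨h.absolutelyContinuousOnInterval_intervalIntegral (by simp), ?_⟩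
  filter_upwards [h.ae_hasDerivAt_integral] with x hx hx'
  exact hx (by rwa [uIcc_zero_pi]) 0 (by simp)

/-- Agreement on [0, π] alone controls two-sided derivatives only at interior points; the two
endpoints form a null set. -/
theorem congr_fun (hf : ACD f f') (h : ∀ x ∈ Icc 0 π, f x = g x) : ACD g f' := by
  refine ⟨absolutelyContinuousOnInterval_congr hf.ac (by rwa [uIcc_zero_pi]), ?_⟩
  have h0 : ∀ᵐ x : ℝ, x ≠ 0 := by simp [ae_iff, measure_singleton]
  have h1 : ∀ᵐ x : ℝ, x ≠ π := by simp [ae_iff, measure_singleton]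
  filter_upwards [hf.hasDerivAt_ae, h0, h1] with x h2 h3 h4 hx
  refine (h2 hx).congr_of_eventuallyEq ?_
  filter_upwards [Icc_mem_nhds (lt_of_le_of_ne hx.1 h3.symm) (lt_of_le_of_ne hx.2 h4)] with y hy
  exact (h y hy).symm

end ACD

theorem intervalIntegrable_sub {f : ℝ → ℝ} (hf : IntervalIntegrable f volume 0 π) {x : ℝ}
    (hx : x ∈ Icc 0 π) : IntervalIntegrable f volume 0 x :=
  hf.mono_set (by rw [uIcc_zero_pi, uIcc_of_le hx.1]; exact Icc_subset_Icc_right hx.2)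

theorem intervalIntegrable_mul_continuousOn {f g : ℝ → ℝ} (hf : IntervalIntegrable f volume 0 π)
    (hg : ContinuousOn g (Icc 0 π)) : IntervalIntegrable (fun x => f x * g x) volume 0 π :=
  hf.mul_continuousOn (by rwa [uIcc_zero_pi])

theorem intervalIntegrable_of_continuousOn {g : ℝ → ℝ}
    (hg : ContinuousOn g (Icc 0 π)) : IntervalIntegrable g volume 0 π :=
  ContinuousOn.intervalIntegrable (by rwa [uIcc_zero_pi])

/-! ### Linear scalar equations, Gronwall bounds and uniqueness -/

/-- Variation of constants for a scalar linear equation with integrable coefficient. -/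
theorem ACD.linear_ode {f R g : ℝ → ℝ} (hf : ACD f fun x => R x * f x + g x)
    (hR : IntervalIntegrable R volume 0 π) {x : ℝ} (hx : x ∈ Icc 0 π) :
    f x = exp (∫ t in (0 : ℝ)..x, R t) *
      (f 0 + ∫ t in (0 : ℝ)..x, exp (-∫ s in (0 : ℝ)..t, R s) * g t) := by
  have h1 : ACD (fun x => exp (-∫ s in (0 : ℝ)..x, R s) * f x)
      fun t => exp (-∫ s in (0 : ℝ)..t, R s) * g t :=
    ((ACD.of_integral hR).neg.exp.mul hf).congr_deriv fun t _ => by ring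
  rw [h1.integral_eq_sub hx]
  simp [← mul_assoc, ← Real.exp_add]

/-- Linear differential inequality: Gronwall from below. -/
theorem ACD.le_of_linear_le {f f' R : ℝ → ℝ} (hf : ACD f f')
    (hR : IntervalIntegrable R volume 0 π) (h : ∀ x ∈ Icc 0 π, R x * f x ≤ f' x) {x : ℝ}
    (hx : x ∈ Icc 0 π) : exp (∫ t in (0 : ℝ)..x, R t) * f 0 ≤ f x := by
  have h1 : ACD f fun x => R x * f x + (f' x - R x * f x) :=
    hf.congr_deriv fun x _ => by ring
  rw [h1.linear_ode hR hx]
  refine mul_le_mul_of_nonneg_left ?_ (Real.exp_pos _).le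
  have : 0 ≤ ∫ t in (0 : ℝ)..x, exp (-∫ s in (0 : ℝ)..t, R s) * (f' t - R t * f t) :=
    intervalIntegral.integral_nonneg hx.1 fun t ht =>
      mul_nonneg (Real.exp_pos _).le (sub_nonneg.2 (h t ⟨ht.1, ht.2.trans hx.2⟩))
  linarith

/-- `y` is a real solution of `-y'' + q y = l y` on `[0, π]` with `y' = z`. -/
structure RealSol (q : ℝ → ℝ) (l : ℝ) (y z : ℝ → ℝ) : Prop where
  fst : ACD y z
  snd : ACD z fun x => (q x - l) * y x

namespace RealSol

variable {q : ℝ → ℝ} {l : ℝ} {y z y' z' : ℝ → ℝ}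

theorem sub (h : RealSol q l y z) (h' : RealSol q l y' z') :
    RealSol q l (fun x => y x - y' x) fun x => z x - z' x :=
  ⟨h.fst.sub h'.fst, (h.snd.sub h'.snd).congr_deriv fun x _ => by ring⟩

theorem const_mul (a : ℝ) (h : RealSol q l y z) :
    RealSol q l (fun x => a * y x) fun x => a * z x :=
  ⟨h.fst.const_mul a, (h.snd.const_mul a).congr_deriv fun x _ => by ring⟩

/-- The derivative of y² + z² is at most |1 + q - l| times y² + z² in absolute value, so Gronwall
applies in both directions: a nonzero solution never has y = z = 0, and zero data force the zero
solution. -/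
theorem energy (h : RealSol q l y z) :
    ACD (fun x => y x * y x + z x * z x) fun x => 2 * (1 + q x - l) * (y x * z x) :=
  ((h.fst.mul h.fst).add (h.snd.mul h.snd)).congr_deriv fun x _ => by ring

theorem intervalIntegrable_energy_rate (hq : IntervalIntegrable q volume 0 π) (l : ℝ) :
    IntervalIntegrable (fun x => |1 + q x - l|) volume 0 π :=
  ((intervalIntegrable_const.add hq).sub intervalIntegrable_const).abs

theorem abs_two_mul_le (a y z : ℝ) : |2 * a * (y * z)| ≤ |a| * (y * y + z * z) := by
  rw [abs_mul, abs_mul, abs_two, mul_comm 2, mul_assoc]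
  refine mul_le_mul_of_nonneg_left ?_ (abs_nonneg a)
  rcases abs_cases (y * z) with ⟨h, -⟩ | ⟨h, -⟩ <;> rw [h] <;>
    nlinarith [sq_nonneg (y - z), sq_nonneg (y + z)]

theorem energy_pos (hq : IntervalIntegrable q volume 0 π) (h : RealSol q l y z)
    (h0 : y 0 ≠ 0 ∨ z 0 ≠ 0) {x : ℝ} (hx : x ∈ Icc 0 π) : 0 < y x * y x + z x * z x := by
  have h1 := h.energy.le_of_linear_le (intervalIntegrable_energy_rate hq l).neg
    (fun x _ => by
      have := (abs_le.1 (abs_two_mul_le (1 + q x - l) (y x) (z x))).1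
      simp only [Pi.neg_apply]
      linarith) hx
  refine lt_of_lt_of_le (mul_pos (Real.exp_pos _) ?_) h1
  rcases h0 with h0 | h0
  · nlinarith [mul_self_pos.2 h0, mul_self_nonneg (z 0)]
  · nlinarith [mul_self_pos.2 h0, mul_self_nonneg (y 0)]

theorem eq_zero (hq : IntervalIntegrable q volume 0 π) (h : RealSol q l y z)
    (h0 : y 0 = 0) (h0' : z 0 = 0) {x : ℝ} (hx : x ∈ Icc 0 π) : y x = 0 ∧ z x = 0 := by
  -- The lower Gronwall bound for the negated energy is an upper bound for the energy.
  have h1 := h.energy.neg.le_of_linear_le (intervalIntegrable_energy_rate hq l)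
    (fun x _ => by
      have := (abs_le.1 (abs_two_mul_le (1 + q x - l) (y x) (z x))).2
      linarith) hx
  simp only [h0, h0', mul_zero, add_zero, neg_zero] at h1
  constructor <;> nlinarith [mul_self_nonneg (y x), mul_self_nonneg (z x)]

theorem unique (hq : IntervalIntegrable q volume 0 π) (h : RealSol q l y z)
    (h' : RealSol q l y' z') (h0 : y 0 = y' 0) (h0' : z 0 = z' 0) {x : ℝ} (hx : x ∈ Icc 0 π) :
    y x = y' x ∧ z x = z' x := by
  have := (h.sub h').eq_zero hq (sub_eq_zero.2 h0) (sub_eq_zero.2 h0') hx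
  exact ⟨sub_eq_zero.1 this.1, sub_eq_zero.1 this.2⟩

end RealSol

/-! ### Existence for the initial value problem -/

/-- With the weight exp(2 ∫ p) built into the norm, this integral makes the Volterra operator a
contraction with factor 1/2 on the whole interval, so no iteration over short intervals is needed.
-/
theorem integral_weight {p : ℝ → ℝ} (hp : IntervalIntegrable p volume 0 π) {x : ℝ}
    (hx : x ∈ Icc 0 π) :
    ∫ t in (0 : ℝ)..x, exp (2 * ∫ s in (0 : ℝ)..t, p s) * p t =
      (exp (2 * ∫ s in (0 : ℝ)..x, p s) - 1) / 2 := by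
  have h1 : ACD (fun x => (1 / 2 : ℝ) * exp (2 * ∫ s in (0 : ℝ)..x, p s))
      fun t => exp (2 * ∫ s in (0 : ℝ)..t, p s) * p t :=
    ((((ACD.of_integral hp).const_mul 2).exp).const_mul (1 / 2)).congr_deriv fun t _ => by ring
  rw [h1.integral_eq_sub hx]
  simp
  ring

/-- A Volterra integral equation of the form needed for second order equations is solvable. -/
theorem exists_volterra {r : ℝ → ℝ} (hr : IntervalIntegrable r volume 0 π) (a b : ℝ) :
    ∃ y : ℝ → ℝ, ContinuousOn y (Icc 0 π) ∧ ∀ x ∈ Icc 0 π,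
      y x = a + b * x + ∫ t in (0 : ℝ)..x, (x - t) * (r t * y t) := by
  -- `p` dominates the kernel |x - t| |r t| for 0 ≤ t ≤ x ≤ π.
  set p : ℝ → ℝ := fun t => π * |r t| with hp
  have hpi : IntervalIntegrable p volume 0 π := hr.abs.const_mul π
  set P : ℝ → ℝ := fun x => ∫ t in (0 : ℝ)..x, p t with hP
  have hPc : ContinuousOn P (Icc 0 π) := (ACD.of_integral hpi).continuousOn
  have hPe : ContinuousOn (fun x => exp (2 * P x)) (Icc 0 π) :=
    Real.continuous_exp.comp_continuousOn (continuousOn_const.mul hPc)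
  have hPe' : ContinuousOn (fun x => exp (-(2 * P x))) (Icc 0 π) :=
    Real.continuous_exp.comp_continuousOn (continuousOn_const.mul hPc).neg
  let ext : C(Icc (0 : ℝ) π, ℝ) → ℝ → ℝ := fun w => IccExtend pi_pos.le w
  have hext : ∀ w, Continuous (ext w) := fun w => w.continuous.Icc_extend'
  have hf : ∀ w, IntervalIntegrable (fun t => r t * (exp (2 * P t) * ext w t)) volume 0 π :=
    fun w => intervalIntegrable_mul_continuousOn hr (hPe.mul (hext w).continuousOn)
  have hkint : ∀ w x, x ∈ Icc 0 π → IntervalIntegrable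
      (fun t => (x - t) * (r t * (exp (2 * P t) * ext w t))) volume 0 x := fun w x hx =>
    (intervalIntegrable_sub (hf w) hx).continuousOn_mul (by fun_prop)
  have hk : ∀ w, ContinuousOn (fun x => ∫ t in (0 : ℝ)..x,
      (x - t) * (r t * (exp (2 * P t) * ext w t))) (Icc 0 π) := by
    intro w
    have h1 : ContinuousOn (fun x => x * (∫ t in (0 : ℝ)..x, r t * (exp (2 * P t) * ext w t)) -
        ∫ t in (0 : ℝ)..x, (r t * (exp (2 * P t) * ext w t)) * t) (Icc 0 π) :=
      (continuousOn_id.mul (ACD.of_integral (hf w)).continuousOn).sub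
        (ACD.of_integral (intervalIntegrable_mul_continuousOn (hf w) continuousOn_id)).continuousOn
    refine h1.congr fun x hx => ?_
    beta_reduce
    rw [← intervalIntegral.integral_const_mul, ← intervalIntegral.integral_sub]
    · congr 1; ext t; ring
    · exact (intervalIntegrable_sub (hf w) hx).const_mul x
    · exact intervalIntegrable_sub (intervalIntegrable_mul_continuousOn (hf w) continuousOn_id) hx
  have hT : ∀ w, ContinuousOn (fun x => exp (-(2 * P x)) * (a + b * x + ∫ t in (0 : ℝ)..x,
      (x - t) * (r t * (exp (2 * P t) * ext w t)))) (Icc 0 π) := fun w =>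
    hPe'.mul ((by fun_prop : ContinuousOn (fun x : ℝ => a + b * x) (Icc 0 π)).add (hk w))
  -- `T` is the Volterra operator conjugated by the weight: its unknown is w = exp(-2P) y.
  let T : C(Icc (0 : ℝ) π, ℝ) → C(Icc (0 : ℝ) π, ℝ) := fun w => ⟨_, (hT w).domRestrict⟩
  have hcontr : ContractingWith (1 / 2 : NNReal) T := by
    refine ⟨by norm_num, LipschitzWith.of_dist_le_mul fun w v => ?_⟩
    rw [ContinuousMap.dist_le (by positivity)]
    rintro ⟨x, hx⟩
    have hval : ∀ u, T u ⟨x, hx⟩ = exp (-(2 * P x)) * (a + b * x + ∫ t in (0 : ℝ)..x,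
      (x - t) * (r t * (exp (2 * P t) * ext u t))) := fun u => rfl
    rw [hval, hval, Real.dist_eq, ← mul_sub, add_sub_add_left_eq_sub,
      ← intervalIntegral.integral_sub (hkint w x hx) (hkint v x hx), abs_mul,
      abs_of_pos (Real.exp_pos _)]
    have hb : |∫ t in (0 : ℝ)..x, ((x - t) * (r t * (exp (2 * P t) * ext w t)) -
        (x - t) * (r t * (exp (2 * P t) * ext v t)))| ≤
        ∫ t in (0 : ℝ)..x, dist w v * (exp (2 * P t) * p t) := by
      rw [← Real.norm_eq_abs]
      refine intervalIntegral.norm_integral_le_of_norm_le hx.1 (ae_of_all _ fun t ht => ?_) ?_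
      · have ht' : t ∈ Icc 0 π := ⟨ht.1.le, ht.2.trans hx.2⟩
        have e : (x - t) * (r t * (exp (2 * P t) * ext w t)) -
            (x - t) * (r t * (exp (2 * P t) * ext v t)) =
            (x - t) * r t * exp (2 * P t) * (ext w t - ext v t) := by ring
        rw [e, Real.norm_eq_abs, abs_mul, abs_mul, abs_mul, abs_of_pos (Real.exp_pos _)]
        have h1 : |ext w t - ext v t| ≤ dist w v := by
          rw [← Real.dist_eq]
          simp only [ext, IccExtend_of_mem _ _ ht']
          exact ContinuousMap.dist_apply_le_dist _
        have h2 : |x - t| ≤ π := by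
          rw [abs_of_nonneg (by linarith [ht.2])]; linarith [ht.1, hx.2]
        calc |x - t| * |r t| * exp (2 * P t) * |ext w t - ext v t|
            ≤ π * |r t| * exp (2 * P t) * dist w v := by gcongr
          _ = _ := by simp only [hp]; ring
      · refine (intervalIntegrable_sub ?_ hx).const_mul _
        exact hpi.continuousOn_mul (by rwa [uIcc_zero_pi])
    rw [intervalIntegral.integral_const_mul, integral_weight hpi hx] at hb
    calc exp (-(2 * P x)) * _ ≤ exp (-(2 * P x)) * (dist w v * ((exp (2 * P x) - 1) / 2)) := by
          gcongr
      _ = dist w v * ((exp (-(2 * P x)) * exp (2 * P x) - exp (-(2 * P x))) / 2) := by ring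
      _ = dist w v * ((1 - exp (-(2 * P x))) / 2) := by rw [← Real.exp_add]; simp
      _ ≤ dist w v * (1 / 2) := by
          gcongr
          linarith [Real.exp_pos (-(2 * P x))]
      _ = _ := by simp [mul_comm]
  set w := ContractingWith.fixedPoint T hcontr
  have hw : T w = w := hcontr.fixedPoint_isFixedPt
  refine ⟨fun x => exp (2 * P x) * ext w x, hPe.mul (hext w).continuousOn, fun x hx => ?_⟩
  have h1 : ext w x = T w ⟨x, hx⟩ := by rw [hw]; exact IccExtend_of_mem _ _ hx
  have h2 : T w ⟨x, hx⟩ = exp (-(2 * P x)) * (a + b * x + ∫ t in (0 : ℝ)..x,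
      (x - t) * (r t * (exp (2 * P t) * ext w t))) := rfl
  show exp (2 * P x) * ext w x = _
  rw [h1, h2, ← mul_assoc, ← Real.exp_add]
  simp

theorem RealSol.exists {q : ℝ → ℝ} (hq : IntervalIntegrable q volume 0 π) (l a b : ℝ) :
    ∃ y z : ℝ → ℝ, Continuous y ∧ Continuous z ∧ RealSol q l y z ∧ y 0 = a ∧ z 0 = b := by
  have hr : IntervalIntegrable (fun x => q x - l) volume 0 π := hq.sub intervalIntegrable_const
  obtain ⟨y, hyc, hy⟩ := exists_volterra hr a b
  set f : ℝ → ℝ := fun x => (q x - l) * y x with hf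
  have hfi : IntervalIntegrable f volume 0 π := intervalIntegrable_mul_continuousOn hr hyc
  have hz : ACD (fun x => b + ∫ t in (0 : ℝ)..x, f t) f :=
    ((ACD.const b).add (ACD.of_integral hfi)).congr_deriv fun x _ => by ring
  have hfti := intervalIntegrable_mul_continuousOn hfi continuousOn_id
  -- The kernel splits as x ∫ f - ∫ t f, and in its derivative the two terms x f(x) cancel, leaving
  -- ∫ f.
  have hy1 : ACD y fun x => b + ∫ t in (0 : ℝ)..x, f t := by
    refine ((((ACD.const a).add (ACD.id.const_mul b)).add
      ((ACD.id.mul (ACD.of_integral hfi)).sub (ACD.of_integral hfti))).congr_fun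
        fun x hx => ?_).congr_deriv fun x _ => ?_
    · rw [hy x hx, ← intervalIntegral.integral_const_mul, ← intervalIntegral.integral_sub]
      · congr 2; ext t; simp only [hf, id]; ring
      · exact (intervalIntegrable_sub hfi hx).const_mul x
      · exact intervalIntegrable_sub hfti hx
    · simp only [id]; ring
  -- Constant extension beyond [0, π] makes both functions continuous on the whole line.
  have e : ∀ (u : ℝ → ℝ), ∀ x ∈ Icc 0 π, u x = IccExtend pi_pos.le (fun t : Icc 0 π => u t) x :=
    fun u x hx => by rw [IccExtend_of_mem _ _ hx]
  have hzc := hz.continuousOn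
  refine ⟨IccExtend pi_pos.le fun t : Icc 0 π => y t,
    IccExtend pi_pos.le fun t : Icc 0 π => b + ∫ t in (0 : ℝ)..t, f t,
    hyc.domRestrict.Icc_extend', hzc.domRestrict.Icc_extend', ⟨?_, ?_⟩, ?_, ?_⟩
  · exact (hy1.congr_fun (e y)).congr_deriv (e fun x => b + ∫ t in (0 : ℝ)..x, f t)
  · refine (hz.congr_fun (e _)).congr_deriv fun x hx => ?_
    rw [← e y x hx]
  · rw [← e y 0 ⟨le_rfl, pi_pos.le⟩, hy 0 ⟨le_rfl, pi_pos.le⟩]; simp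
  · rw [← e (fun x => b + ∫ t in (0 : ℝ)..x, f t) 0 ⟨le_rfl, pi_pos.le⟩]; simp

/-! ### Solutions for large spectral parameter -/

theorem zero_mem : (0 : ℝ) ∈ Icc 0 π := ⟨le_rfl, pi_pos.le⟩

theorem pi_mem : π ∈ Icc 0 π := ⟨pi_pos.le, le_rfl⟩

theorem abs_integral_le_of_abs_le {f g : ℝ → ℝ} (hg : IntervalIntegrable g volume 0 π)
    (hfg : ∀ t ∈ Icc 0 π, |f t| ≤ g t) {x : ℝ} (hx : x ∈ Icc 0 π) :
    |∫ t in (0 : ℝ)..x, f t| ≤ ∫ t in (0 : ℝ)..π, g t := by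
  have h1 : |∫ t in (0 : ℝ)..x, f t| ≤ ∫ t in (0 : ℝ)..x, g t := by
    rw [← Real.norm_eq_abs]
    exact intervalIntegral.norm_integral_le_of_norm_le hx.1
      (ae_of_all _ fun t ht => hfg t ⟨ht.1.le, ht.2.trans hx.2⟩) (intervalIntegrable_sub hg hx)
  refine h1.trans (intervalIntegral.integral_mono_interval le_rfl hx.1 hx.2 ?_ hg)
  rw [Filter.EventuallyLE, ae_restrict_iff' measurableSet_Ioc]
  exact ae_of_all _ fun t ht => (abs_nonneg _).trans (hfg t (Ioc_subset_Icc_self ht))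

theorem abs_integral_le_mul {q f : ℝ → ℝ} {M : ℝ} (hq : IntervalIntegrable q volume 0 π)
    (hf : ∀ t ∈ Icc 0 π, |f t| ≤ |q t| * M) {x : ℝ} (hx : x ∈ Icc 0 π) :
    |∫ t in (0 : ℝ)..x, f t| ≤ (∫ t in (0 : ℝ)..π, |q t|) * M := by
  rw [← intervalIntegral.integral_mul_const]
  exact abs_integral_le_of_abs_le (hq.abs.mul_const M) hf hx

theorem integral_abs_nonneg (q : ℝ → ℝ) : 0 ≤ ∫ t in (0 : ℝ)..π, |q t| :=
  intervalIntegral.integral_nonneg pi_pos.le fun _ _ => abs_nonneg _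

theorem exists_max_abs {y : ℝ → ℝ} (hy : ContinuousOn y (Icc 0 π)) :
    ∃ x₀ ∈ Icc 0 π, ∀ x ∈ Icc 0 π, |y x| ≤ |y x₀| := by
  obtain ⟨x₀, h1, h2⟩ := isCompact_Icc.exists_isMaxOn ⟨0, zero_mem⟩ hy.abs
  exact ⟨x₀, h1, h2⟩

theorem abs_mul_cos_add_mul_sin_le (a b t : ℝ) : |a * cos t + b * sin t| ≤ |a| + |b| := by
  refine (abs_add_le _ _).trans ?_
  rw [abs_mul, abs_mul]
  have := abs_cos_le_one t
  have := abs_sin_le_one t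
  nlinarith [abs_nonneg a, abs_nonneg b]

/-- Asymptotics of solutions for large positive spectral parameter. -/
theorem RealSol.trig_asymptotics {q y z : ℝ → ℝ} {r h : ℝ} (hq : IntervalIntegrable q volume 0 π)
    (hy : RealSol q (r ^ 2) y z) (hy0 : y 0 = 1) (hz0 : z 0 = h) (hr1 : 1 ≤ r)
    (hr : 4 * (∫ t in (0 : ℝ)..π, |q t|) ≤ r) {x : ℝ} (hx : x ∈ Icc 0 π) :
    |y x| ≤ 2 * (1 + |h|) ∧
    |y x - cos (r * x)| ≤ (|h| + 4 * (∫ t in (0 : ℝ)..π, |q t|) * (1 + |h|)) / r ∧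
    |z x + r * sin (r * x)| ≤ |h| + 4 * (∫ t in (0 : ℝ)..π, |q t|) * (1 + |h|) := by
  set Q := ∫ t in (0 : ℝ)..π, |q t| with hQ
  have hr0 : 0 < r := by linarith
  have hQ0 : 0 ≤ Q := integral_abs_nonneg q
  obtain ⟨x₀, hx₀, hM⟩ := exists_max_abs hy.fst.continuousOn
  set M := |y x₀| with hMdef
  have hM0 : 0 ≤ M := abs_nonneg _
  have hlin : ACD (fun x => r * x) fun _ => r := (ACD.id.const_mul r).congr_deriv fun x _ => by ring
  -- Rotating the vector (r y, z) by the angle r x gives coordinates that are constant when q = 0;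
  -- their derivatives contain only q y.
  have hp : ACD (fun x => r * (y x * cos (r * x)) - z x * sin (r * x))
      fun x => -(q x * y x * sin (r * x)) :=
    (((hy.fst.mul hlin.cos).const_mul r).sub (hy.snd.mul hlin.sin)).congr_deriv
      fun x _ => by ring
  have hs : ACD (fun x => r * (y x * sin (r * x)) + z x * cos (r * x))
      fun x => q x * y x * cos (r * x) :=
    (((hy.fst.mul hlin.sin).const_mul r).add (hy.snd.mul hlin.cos)).congr_deriv
      fun x _ => by ring
  have key : ∀ x ∈ Icc 0 π, ∃ a b : ℝ, |a| ≤ Q * M ∧ |b| ≤ |h| + Q * M ∧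
      r * (y x - cos (r * x)) = a * cos (r * x) + b * sin (r * x) ∧
      z x + r * sin (r * x) = b * cos (r * x) + (-a) * sin (r * x) := by
    intro x hx
    have e1 := hp.integral_eq_sub hx
    have e2 := hs.integral_eq_sub hx
    simp only [hy0, hz0, mul_zero, cos_zero, sin_zero, mul_one, sub_zero, zero_add] at e1 e2
    have b1 := abs_integral_le_mul (f := fun x => -(q x * y x * sin (r * x))) (M := M) hq
      (fun t ht => by
        rw [abs_neg, abs_mul, abs_mul]
        exact (mul_le_of_le_one_right (by positivity) (abs_sin_le_one _)).trans
          (mul_le_mul_of_nonneg_left (hM t ht) (abs_nonneg _))) hx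
    have b2 := abs_integral_le_mul (f := fun x => q x * y x * cos (r * x)) (M := M) hq
      (fun t ht => by
        rw [abs_mul, abs_mul]
        exact (mul_le_of_le_one_right (by positivity) (abs_cos_le_one _)).trans
          (mul_le_mul_of_nonneg_left (hM t ht) (abs_nonneg _))) hx
    rw [e1] at b1
    rw [e2] at b2
    have hcs := sin_sq_add_cos_sq (r * x)
    refine ⟨_, r * (y x * sin (r * x)) + z x * cos (r * x), b1, ?_, ?_, ?_⟩
    · have := abs_sub_abs_le_abs_sub (r * (y x * sin (r * x)) + z x * cos (r * x)) h
      linarith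
    · linear_combination (-(r * y x)) * hcs
    · linear_combination (-z x) * hcs
  have hy1 : ∀ x ∈ Icc 0 π, r * |y x - cos (r * x)| ≤ |h| + 2 * (Q * M) := by
    intro x hx
    obtain ⟨a, b, ha, hb, e, -⟩ := key x hx
    rw [← abs_of_pos hr0, ← abs_mul, abs_of_pos hr0, e]
    exact (abs_mul_cos_add_mul_sin_le _ _ _).trans (by linarith)
  -- The estimate at the maximum point bounds `M` in terms of itself; the condition 4Q ≤ r absorbs
  -- the term with `Q * M`.
  have hM2 : M ≤ 2 * (1 + |h|) := by
    have h1 := hy1 x₀ hx₀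
    have h2 : M ≤ |y x₀ - cos (r * x₀)| + 1 := by
      have := abs_sub_abs_le_abs_sub (y x₀) (cos (r * x₀))
      have := abs_cos_le_one (r * x₀)
      linarith
    have h3 : r * M ≤ |h| + 2 * (Q * M) + r := by nlinarith
    have h4 : 4 * (Q * M) ≤ r * M := by nlinarith
    have h5 : r * M ≤ r * (2 * (1 + |h|)) := by nlinarith [abs_nonneg h]
    exact le_of_mul_le_mul_left h5 hr0
  have hfin : |h| + 2 * (Q * M) ≤ |h| + 4 * Q * (1 + |h|) := by nlinarith
  refine ⟨(hM x hx).trans hM2, ?_, ?_⟩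
  · rw [le_div_iff₀ hr0, mul_comm]
    exact (hy1 x hx).trans hfin
  · obtain ⟨a, b, ha, hb, -, e⟩ := key x hx
    rw [e]
    refine (abs_mul_cos_add_mul_sin_le _ _ _).trans ?_
    rw [abs_neg]
    linarith

/-- Positivity and logarithmic derivative of solutions for large negative spectral parameter. -/
theorem RealSol.hyperbolic_asymptotics {q y z : ℝ → ℝ} {k h : ℝ}
    (hq : IntervalIntegrable q volume 0 π)
    (hy : RealSol q (-k ^ 2) y z) (hy0 : y 0 = 1) (hz0 : z 0 = h) (hk1 : 1 ≤ k)
    (hk : 4 * (|h| + 2 * (∫ t in (0 : ℝ)..π, |q t|) * (1 + |h|)) ≤ k) :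
    (∀ x ∈ Icc 0 π, 0 < y x) ∧
    |z π / y π - k| ≤ 4 * (exp (-(2 * k * π)) * (|h| + k) +
      2 * (1 + |h|) * ∫ t in (0 : ℝ)..π, exp (-(2 * k * (π - t))) * |q t|) := by
  set Q := ∫ t in (0 : ℝ)..π, |q t| with hQ
  have hk0 : 0 < k := by linarith
  have hQ0 : 0 ≤ Q := integral_abs_nonneg q
  -- Dividing by the expected growth exp(kx) leaves a bounded function.
  set V : ℝ → ℝ := fun x => exp (-(k * x)) * y x with hV
  have hlin : ACD (fun x => k * x) fun _ => k := (ACD.id.const_mul k).congr_deriv fun x _ => by ring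
  have hVc : ContinuousOn V (Icc 0 π) := (hlin.neg.exp.mul hy.fst).continuousOn
  obtain ⟨x₀, hx₀, hM⟩ := exists_max_abs hVc
  set M := |V x₀| with hMdef
  have hM0 : 0 ≤ M := abs_nonneg _
  -- y' + ky and y' - ky diagonalize the equation for q = 0: the former grows like exp(kx), the
  -- latter decays like exp(-kx).
  have hp : ACD (fun x => exp (-(k * x)) * (z x + k * y x)) fun x => q x * V x :=
    (hlin.neg.exp.mul (hy.snd.add (hy.fst.const_mul k))).congr_deriv
      fun x _ => by simp only [hV]; ring
  have hm : ACD (fun x => exp (k * x) * (z x - k * y x)) fun x => exp (2 * k * x) * (q x * V x) :=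
    (hlin.exp.mul (hy.snd.sub (hy.fst.const_mul k))).congr_deriv
      fun x _ => by
        have : exp (2 * k * x) * exp (-(k * x)) = exp (k * x) := by
          rw [← Real.exp_add]; congr 1; ring
        simp only [hV]
        linear_combination (-(q x * y x)) * this
  have e1 : ∀ x ∈ Icc 0 π, |exp (-(k * x)) * (z x + k * y x) - (h + k)| ≤ Q * M := by
    intro x hx
    have b := abs_integral_le_mul (f := fun x => q x * V x) (M := M) hq (fun t ht => by
        rw [abs_mul]; exact mul_le_mul_of_nonneg_left (hM t ht) (abs_nonneg _)) hx
    rw [hp.integral_eq_sub hx] at b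
    simpa [hy0, hz0] using b
  have e2' : ∀ x ∈ Icc 0 π, exp (-(k * x)) * (z x - k * y x) =
      exp (-(2 * k * x)) * ((h - k) + ∫ t in (0 : ℝ)..x, exp (2 * k * t) * (q t * V t)) := by
    intro x hx
    rw [hm.integral_eq_sub hx]
    simp only [hy0, hz0, mul_zero, Real.exp_zero, one_mul, mul_one]
    rw [add_sub_cancel, ← mul_assoc, ← Real.exp_add]
    congr 2; ring
  have e2'' : ∀ x ∈ Icc 0 π, |exp (-(2 * k * x)) *
      ∫ t in (0 : ℝ)..x, exp (2 * k * t) * (q t * V t)| ≤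
      ∫ t in (0 : ℝ)..x, exp (-(2 * k * (x - t))) * (|q t| * M) := by
    intro x hx
    rw [← intervalIntegral.integral_const_mul, ← Real.norm_eq_abs]
    refine intervalIntegral.norm_integral_le_of_norm_le hx.1 (ae_of_all _ fun t ht => ?_) ?_
    · rw [Real.norm_eq_abs, ← mul_assoc, ← Real.exp_add, abs_mul, abs_mul,
        abs_of_pos (Real.exp_pos _)]
      have : -(2 * k * x) + 2 * k * t = -(2 * k * (x - t)) := by ring
      rw [this]
      gcongr
      exact hM t ⟨ht.1.le, ht.2.trans hx.2⟩
    · exact (intervalIntegrable_sub (hq.abs.mul_const M) hx).continuousOn_mul (by fun_prop)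
  have e2 : ∀ x ∈ Icc 0 π, |exp (-(k * x)) * (z x - k * y x) - exp (-(2 * k * x)) * (h - k)| ≤
      Q * M := by
    intro x hx
    rw [e2' x hx, mul_add, add_sub_cancel_left]
    have hb : ∫ t in (0 : ℝ)..x, exp (-(2 * k * (x - t))) * (|q t| * M) ≤
        ∫ t in (0 : ℝ)..x, |q t| * M := by
      refine intervalIntegral.integral_mono_on hx.1
        ((intervalIntegrable_sub (hq.abs.mul_const M) hx).continuousOn_mul (by fun_prop))
        (intervalIntegrable_sub (hq.abs.mul_const M) hx) fun t ht => ?_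
      refine mul_le_of_le_one_left (by positivity) (Real.exp_le_one_iff.2 ?_)
      nlinarith [mul_nonneg hk0.le (sub_nonneg.2 ht.2)]
    refine (e2'' x hx).trans (hb.trans ((le_abs_self _).trans
      (abs_integral_le_mul hq (fun t ht => ?_) hx)))
    rw [abs_mul, abs_abs, abs_of_nonneg hM0]
  have hexp : ∀ x ∈ Icc 0 π, exp (-(2 * k * x)) ≤ 1 := fun x hx =>
    Real.exp_le_one_iff.2 (by nlinarith [hx.1])
  have hVx : ∀ x ∈ Icc 0 π, |2 * k * V x - k * (1 + exp (-(2 * k * x)))| ≤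
      2 * (|h| + Q * M) := by
    intro x hx
    have h1 := abs_le.1 (e1 x hx)
    have h2 := abs_le.1 (e2 x hx)
    have h3 : |h * exp (-(2 * k * x))| ≤ |h| := by
      rw [abs_mul, abs_of_pos (Real.exp_pos _)]
      exact mul_le_of_le_one_right (abs_nonneg _) (hexp x hx)
    have h3 := abs_le.1 h3
    have h4 := abs_le.1 (le_refl |h|)
    rw [abs_le]
    simp only [hV]
    constructor <;> nlinarith
  have hM2 : M ≤ 2 * (1 + |h|) := by
    have h1 := hVx x₀ hx₀
    have h2 := abs_sub_abs_le_abs_sub (2 * k * V x₀) (k * (1 + exp (-(2 * k * x₀))))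
    rw [abs_mul, abs_of_pos (by positivity : 0 < 2 * k),
      abs_of_pos (by positivity : 0 < k * (1 + exp (-(2 * k * x₀))))] at h2
    have h3 := hexp x₀ hx₀
    have h4 : 2 * k * M ≤ 2 * k + 2 * (|h| + Q * M) := by nlinarith
    have h5 : 8 * (Q * M) ≤ k * M := by
      have : 8 * Q ≤ k := by nlinarith [abs_nonneg h]
      nlinarith
    have h6 : k * M ≤ k * (2 * (1 + |h|)) := by nlinarith [abs_nonneg h]
    exact le_of_mul_le_mul_left h6 hk0
  have hQM : Q * M ≤ 2 * Q * (1 + |h|) := by nlinarith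
  have hV4 : ∀ x ∈ Icc 0 π, 1 / 4 ≤ V x := by
    intro x hx
    have h1 := (abs_le.1 (hVx x hx)).1
    have h2 := Real.exp_pos (-(2 * k * x))
    have h3 : k * (1 / 4) ≤ k * V x := by nlinarith
    exact le_of_mul_le_mul_left h3 hk0
  refine ⟨fun x hx => pos_of_mul_pos_right (by linarith [hV4 x hx] : 0 < V x)
    (Real.exp_pos _).le, ?_⟩
  have hVpi := hV4 π pi_mem
  -- Only the decaying component y' - ky enters the numerator, while `V π` is at least 1/4.
  have hyz : z π / y π - k = exp (-(k * π)) * (z π - k * y π) / V π := by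
    have hyp : y π ≠ 0 := fun h0 => by simp [hV, h0] at hVpi; linarith
    have := Real.exp_pos (-(k * π))
    simp only [hV]
    field_simp
  rw [hyz, abs_div, abs_of_pos (by linarith : 0 < V π), div_le_iff₀ (by linarith), e2' π pi_mem,
    mul_add]
  have h1 : |exp (-(2 * k * π)) * (h - k)| ≤ exp (-(2 * k * π)) * (|h| + k) := by
    rw [abs_mul, abs_of_pos (Real.exp_pos _)]
    gcongr
    exact (abs_sub _ _).trans (by rw [abs_of_pos hk0])
  have h2 := e2'' π pi_mem
  have h3 : ∫ t in (0 : ℝ)..π, exp (-(2 * k * (π - t))) * (|q t| * M) =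
      M * ∫ t in (0 : ℝ)..π, exp (-(2 * k * (π - t))) * |q t| := by
    rw [← intervalIntegral.integral_const_mul]; congr 1; ext t; ring
  have h4 : 0 ≤ ∫ t in (0 : ℝ)..π, exp (-(2 * k * (π - t))) * |q t| :=
    intervalIntegral.integral_nonneg pi_pos.le fun t _ => by positivity
  rw [h3] at h2
  have h5 : 0 ≤ exp (-(2 * k * π)) * (|h| + k) := by positivity
  refine (abs_add_le _ _).trans ?_
  have h6 : M * (∫ t in (0 : ℝ)..π, exp (-(2 * k * (π - t))) * |q t|) ≤
      2 * (1 + |h|) * ∫ t in (0 : ℝ)..π, exp (-(2 * k * (π - t))) * |q t| := by gcongr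
  have h7 : 0 ≤ 2 * (1 + |h|) * ∫ t in (0 : ℝ)..π, exp (-(2 * k * (π - t))) * |q t| := by
    positivity
  nlinarith

/-- Dominated convergence with majorant |q|: the integrand tends to 0 for every t ≠ π. No rate is
needed, so q integrable suffices. -/
theorem tendsto_integral_exp_mul {q : ℝ → ℝ} (hq : IntervalIntegrable q volume 0 π) :
    Tendsto (fun k : ℝ => ∫ t in (0 : ℝ)..π, exp (-(2 * k * (π - t))) * |q t|) atTop (𝓝 0) := by
  have key : Tendsto (fun k : ℝ => ∫ t in (0 : ℝ)..π, exp (-(2 * k * (π - t))) * |q t|) atTop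
      (𝓝 (∫ t in (0 : ℝ)..π, (0 : ℝ))) := ?_
  · simpa using key
  refine intervalIntegral.tendsto_integral_filter_of_dominated_convergence (fun t => |q t|)
    ?_ ?_ hq.abs ?_
  · refine Eventually.of_forall fun k => ?_
    have h1 : IntervalIntegrable (fun t => exp (-(2 * k * (π - t))) * |q t|) volume 0 π :=
      hq.abs.continuousOn_mul (by fun_prop)
    rw [uIoc_of_le pi_pos.le]
    exact h1.1.aestronglyMeasurable
  · filter_upwards [eventually_ge_atTop 0] with k hk
    refine ae_of_all _ fun t ht => ?_
    rw [uIoc_of_le pi_pos.le] at ht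
    rw [Real.norm_eq_abs, abs_mul, abs_abs, abs_of_pos (Real.exp_pos _)]
    refine mul_le_of_le_one_left (abs_nonneg _) (Real.exp_le_one_iff.2 ?_)
    have := ht.2
    nlinarith [mul_nonneg hk (sub_nonneg.2 this)]
  · have h1 : ∀ᵐ x : ℝ, x ≠ π := by simp [ae_iff, measure_singleton]
    filter_upwards [h1] with t ht ht'
    rw [uIoc_of_le pi_pos.le] at ht'
    have hpos : 0 < π - t := sub_pos.2 (lt_of_le_of_ne ht'.2 ht)
    rw [show (0 : ℝ) = 0 * |q t| by simp]
    refine Tendsto.mul_const _ (Real.tendsto_exp_atBot.comp (tendsto_neg_atTop_atBot.comp ?_))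
    exact (tendsto_id.const_mul_atTop two_pos).atTop_mul_const hpos

theorem tendsto_exp_mul_add (h : ℝ) :
    Tendsto (fun k : ℝ => exp (-(2 * k * π)) * (h + k)) atTop (𝓝 0) := by
  have h1 : Tendsto (fun k : ℝ => exp (-k)) atTop (𝓝 0) :=
    Real.tendsto_exp_atBot.comp tendsto_neg_atTop_atBot
  have h2 : Tendsto (fun k : ℝ => k ^ 1 * exp (-k)) atTop (𝓝 0) :=
    Real.tendsto_pow_mul_exp_neg_atTop_nhds_zero 1
  have h3 : Tendsto (fun k : ℝ => |h| * exp (-k) + k ^ 1 * exp (-k)) atTop (𝓝 0) := by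
    simpa using (h1.const_mul |h|).add h2
  refine squeeze_zero_norm' ?_ h3
  filter_upwards [eventually_ge_atTop 0] with k hk
  rw [Real.norm_eq_abs, abs_mul, abs_of_pos (Real.exp_pos _)]
  have h4 : exp (-(2 * k * π)) ≤ exp (-k) := Real.exp_le_exp.2 (by nlinarith [pi_gt_three])
  have h5 : |h + k| ≤ |h| + k := (abs_add_le _ _).trans (by rw [abs_of_nonneg hk])
  calc _ ≤ exp (-k) * (|h| + k) := by gcongr
    _ = _ := by ring

/-- The identity obtained by multiplying the equation by `(π - x) y'`. -/
theorem RealSol.integral_sq {q y z : ℝ → ℝ} {l : ℝ} (hq : IntervalIntegrable q volume 0 π)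
    (hy : RealSol q l y z) :
    2 * l * (∫ x in (0 : ℝ)..π, y x ^ 2) = π * (z 0 ^ 2 + l * y 0 ^ 2) + y 0 * z 0 - y π * z π +
      (∫ x in (0 : ℝ)..π, q x * y x ^ 2) +
      2 * ∫ x in (0 : ℝ)..π, (π - x) * q x * (y x * z x) := by
  -- The weight π - x removes z² + l y² at π, and the added product y z cancels the z² produced by
  -- differentiating the weight, so that only y² and terms with q remain.
  have hK : ACD (fun x => (π - x) * (z x * z x + l * (y x * y x)) + y x * z x)
      fun x => q x * y x ^ 2 + 2 * ((π - x) * q x * (y x * z x)) - 2 * l * y x ^ 2 :=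
    ((((ACD.const π).sub ACD.id).mul ((hy.snd.mul hy.snd).add
      ((hy.fst.mul hy.fst).const_mul l))).add (hy.fst.mul hy.snd)).congr_deriv fun x _ => by ring
  have hyc := hy.fst.continuousOn
  have hzc := hy.snd.continuousOn
  have h1 : IntervalIntegrable (fun x => q x * y x ^ 2) volume 0 π :=
    intervalIntegrable_mul_continuousOn hq (hyc.pow 2)
  have h2 : IntervalIntegrable (fun x => (π - x) * q x * (y x * z x)) volume 0 π :=
    intervalIntegrable_mul_continuousOn (hq.continuousOn_mul (by fun_prop)) (hyc.mul hzc)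
  have h3 : IntervalIntegrable (fun x => y x ^ 2) volume 0 π :=
    intervalIntegrable_of_continuousOn (hyc.pow 2)
  have := hK.integral_eq_sub pi_mem
  rw [intervalIntegral.integral_sub (h1.add (h2.const_mul 2)) (h3.const_mul _),
    intervalIntegral.integral_add h1 (h2.const_mul 2), intervalIntegral.integral_const_mul,
    intervalIntegral.integral_const_mul] at this
  linear_combination -this

/-! ### Prüfer angles -/

/-- `θ` is a Prüfer angle with scale `s` for `-y'' + q y = l y`. -/
def PruferEq (q : ℝ → ℝ) (s l : ℝ) (θ : ℝ → ℝ) : Prop :=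
  ACD θ fun x => s * sin (θ x) ^ 2 + (l - q x) / s * cos (θ x) ^ 2

theorem abs_lt_of_cos_pos {x : ℝ} (h : 0 < cos x) (hx : |x| < 3 * π / 2) : |x| < π / 2 := by
  by_contra! h1
  have := cos_nonpos_of_pi_div_two_le_of_le h1 (by linarith)
  rw [cos_abs] at this
  linarith

/-- By continuity |f| would have to take the value π/2, where the cosine vanishes. -/
theorem abs_lt_of_cos_pos_on {f : ℝ → ℝ} (hf : ContinuousOn f (Icc 0 π))
    (hcos : ∀ x ∈ Icc 0 π, 0 < cos (f x)) (h0 : |f 0| < π) {x : ℝ} (hx : x ∈ Icc 0 π) :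
    |f x| < π / 2 := by
  have h1 : |f 0| < π / 2 := abs_lt_of_cos_pos (hcos 0 zero_mem) (by linarith [pi_pos])
  by_contra! h2
  have hsub : Icc 0 x ⊆ Icc 0 π := Icc_subset_Icc_right hx.2
  obtain ⟨c, hc, hc'⟩ := intermediate_value_Icc hx.1 (hf.mono hsub).abs ⟨h1.le, h2⟩
  have := hcos c (hsub hc)
  beta_reduce at hc'
  rw [← cos_abs, hc', cos_pi_div_two] at this
  exact lt_irrefl _ this

/-- No branch of the argument is chosen. The angle is the integral of the angular velocity of (y,
z/s); rotating that vector by θ gives two components `A` and `B` that solve the same equation f' = R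
f. Since B(0) = 0 and A(0) > 0, `B` vanishes identically and `A` stays positive. -/
theorem RealSol.exists_prufer {q y z : ℝ → ℝ} {l h s : ℝ} (hq : IntervalIntegrable q volume 0 π)
    (hy : RealSol q l y z) (hy0 : y 0 = 1) (hz0 : z 0 = h) (hs : 0 < s) :
    ∃ θ A : ℝ → ℝ, PruferEq q s l θ ∧ θ 0 = -arctan (h / s) ∧
      ∀ x ∈ Icc 0 π, 0 < A x ∧ y x = A x * cos (θ x) ∧ z x = -(s * (A x * sin (θ x))) := by
  set v : ℝ → ℝ := fun x => s⁻¹ * z x with hv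
  set g : ℝ → ℝ := fun x => s⁻¹ * (q x - l) with hg
  have hzv : ∀ x, z x = s * v x := fun x => by simp only [hv]; field_simp
  have hy' : ACD y fun x => s * v x := hy.fst.congr_deriv fun x _ => hzv x
  have hv' : ACD v fun x => g x * y x :=
    (hy.snd.const_mul s⁻¹).congr_deriv fun x _ => by simp only [hg]; ring
  set E : ℝ → ℝ := fun x => y x * y x + v x * v x with hE
  have hEpos : ∀ x ∈ Icc 0 π, 0 < E x := by
    intro x hx
    have h1 := hy.energy_pos hq (Or.inl (by rw [hy0]; exact one_ne_zero)) hx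
    rw [hzv] at h1
    simp only [hE]
    by_contra! h2
    have h3 : y x = 0 := by nlinarith [mul_self_nonneg (y x), mul_self_nonneg (v x)]
    have h4 : v x = 0 := by nlinarith [mul_self_nonneg (y x), mul_self_nonneg (v x)]
    simp [h3, h4] at h1
  have hEc : ContinuousOn E (Icc 0 π) :=
    ((hy'.mul hy').add (hv'.mul hv')).continuousOn
  have hyc := hy'.continuousOn
  have hvc := hv'.continuousOn
  have hgi : IntervalIntegrable g volume 0 π := (hq.sub intervalIntegrable_const).const_mul _
  have hEi : ContinuousOn (fun x => (E x)⁻¹) (Icc 0 π) :=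
    hEc.inv₀ fun x hx => (hEpos x hx).ne'
  set ω : ℝ → ℝ := fun x => (s * v x ^ 2 - g x * y x ^ 2) * (E x)⁻¹ with hω
  set R : ℝ → ℝ := fun x => (s * (y x * v x) + g x * (y x * v x)) * (E x)⁻¹ with hR
  have hωi : IntervalIntegrable ω volume 0 π :=
    intervalIntegrable_mul_continuousOn
      ((intervalIntegrable_of_continuousOn (continuousOn_const.mul (hvc.pow 2))).sub
        (intervalIntegrable_mul_continuousOn hgi (hyc.pow 2))) hEi
  have hRi : IntervalIntegrable R volume 0 π :=
    intervalIntegrable_mul_continuousOn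
      ((intervalIntegrable_of_continuousOn (continuousOn_const.mul (hyc.mul hvc))).add
        (intervalIntegrable_mul_continuousOn hgi (hyc.mul hvc))) hEi
  set θ : ℝ → ℝ := fun x => -arctan (h / s) + ∫ t in (0 : ℝ)..x, ω t with hθ
  have hθ0 : θ 0 = -arctan (h / s) := by simp [hθ]
  have hθ' : ACD θ ω := ((ACD.const _).add (ACD.of_integral hωi)).congr_deriv fun x _ => by ring
  have hA : ACD (fun x => y x * cos (θ x) - v x * sin (θ x))
      fun x => R x * (y x * cos (θ x) - v x * sin (θ x)) + 0 :=
    ((hy'.mul hθ'.cos).sub (hv'.mul hθ'.sin)).congr_deriv fun x hx => by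
      have := (hEpos x hx).ne'
      simp only [hω, hR]
      field_simp
      simp only [hE]
      ring
  have hB : ACD (fun x => v x * cos (θ x) + y x * sin (θ x))
      fun x => R x * (v x * cos (θ x) + y x * sin (θ x)) + 0 :=
    ((hv'.mul hθ'.cos).add (hy'.mul hθ'.sin)).congr_deriv fun x hx => by
      have := (hEpos x hx).ne'
      simp only [hω, hR]
      field_simp
      simp only [hE]
      ring
  have hv0 : v 0 = h / s := by simp only [hv, hz0]; ring
  have hcpos : 0 < cos (arctan (h / s)) := cos_arctan_pos _
  have htan : sin (arctan (h / s)) = h / s * cos (arctan (h / s)) := by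
    rw [← tan_mul_cos hcpos.ne', tan_arctan]
  have hA0 : 0 < y 0 * cos (θ 0) - v 0 * sin (θ 0) := by
    rw [hθ0, hv0, hy0, cos_neg, sin_neg, htan]
    nlinarith [mul_nonneg (mul_self_nonneg (h / s)) hcpos.le]
  have hB0 : v 0 * cos (θ 0) + y 0 * sin (θ 0) = 0 := by
    rw [hθ0, hv0, hy0, cos_neg, sin_neg, htan]; ring
  have hBx : ∀ x ∈ Icc 0 π, v x * cos (θ x) + y x * sin (θ x) = 0 := fun x hx => by
    rw [hB.linear_ode hRi hx, hB0]; simp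
  have hyx : ∀ x ∈ Icc 0 π, y x = (y x * cos (θ x) - v x * sin (θ x)) * cos (θ x) := fun x hx => by
    linear_combination (sin (θ x)) * hBx x hx - y x * sin_sq_add_cos_sq (θ x)
  have hvx : ∀ x ∈ Icc 0 π, v x = -((y x * cos (θ x) - v x * sin (θ x)) * sin (θ x)) :=
    fun x hx => by
      linear_combination (cos (θ x)) * hBx x hx - v x * sin_sq_add_cos_sq (θ x)
  refine ⟨θ, fun x => y x * cos (θ x) - v x * sin (θ x), hθ'.congr_deriv fun x hx => ?_, hθ0,
    fun x hx => ⟨?_, hyx x hx, ?_⟩⟩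
  · have hyx' := hyx x hx
    have hvx' := hvx x hx
    obtain ⟨a, ha⟩ : ∃ a, a = y x * cos (θ x) - v x * sin (θ x) := ⟨_, rfl⟩
    rw [← ha] at hyx' hvx'
    have hne := (hEpos x hx).ne'
    have hEa : E x = a ^ 2 := by
      simp only [hE]
      rw [hyx', hvx']
      linear_combination a ^ 2 * sin_sq_add_cos_sq (θ x)
    have ha0 : a ≠ 0 := fun h0 => hne (by rw [hEa, h0]; ring)
    simp only [hω, hEa]
    rw [hyx', hvx']
    simp only [hg]
    field_simp
    ring
  · beta_reduce
    rw [hA.linear_ode hRi hx]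
    simp only [mul_zero, intervalIntegral.integral_zero, add_zero]
    exact mul_pos (Real.exp_pos _) hA0
  · rw [hzv]
    linear_combination s * hvx x hx

/-- Exhibits sin d as a continuous factor times d, which turns the nonlinear Prüfer equation into a
linear one for a difference of angles. -/
theorem sin_eq_sinc_mul (x : ℝ) : sin x = sinc x * x := by
  rcases eq_or_ne x 0 with rfl | hx
  · simp
  · rw [sinc_of_ne_zero hx]; field_simp

/-- The function θ + π/2 satisfies f' = R f + s with s > 0, so it cannot fall to 0. This later
excludes negative indices in the eigenvalue count. -/
theorem PruferEq.neg_pi_div_two_lt {q θ : ℝ → ℝ} {s l : ℝ} (hq : IntervalIntegrable q volume 0 π)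
    (hθ : PruferEq q s l θ) (hs : 0 < s) (h0 : -(π / 2) < θ 0) {x : ℝ} (hx : x ∈ Icc 0 π) :
    -(π / 2) < θ x := by
  set R : ℝ → ℝ := fun x => ((l - q x) / s - s) *
    (sin (θ x + π / 2) * sinc (θ x + π / 2)) with hR
  have hθc := hθ.continuousOn
  have hd : ContinuousOn (fun x => θ x + π / 2) (Icc 0 π) := hθc.add continuousOn_const
  have hRi : IntervalIntegrable R volume 0 π :=
    intervalIntegrable_mul_continuousOn
      (((intervalIntegrable_const.sub hq).div_const s).sub intervalIntegrable_const)
      ((continuous_sin.comp_continuousOn hd).mul (continuous_sinc.comp_continuousOn hd))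
  have h1 : ACD (fun x => θ x + π / 2) fun x => R x * (θ x + π / 2) + s :=
    (ACD.add hθ (ACD.const (π / 2))).congr_deriv fun x _ => by
      simp only [hR]
      rw [mul_assoc, mul_assoc, ← sin_eq_sinc_mul, sin_add_pi_div_two]
      linear_combination s * sin_sq_add_cos_sq (θ x)
  have h2 := h1.le_of_linear_le hRi (fun x _ => by linarith) hx
  have h3 := mul_pos (Real.exp_pos (∫ t in (0 : ℝ)..x, R t)) (by linarith : 0 < θ 0 + π / 2)
  linarith

/-- By sin² a - sin² b = sin(a + b) sin(a - b), the difference of two angles solves a linear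
equation with integrable coefficient, whose source term has the sign of l₂ - l₁. Monotonicity and
continuity in the spectral parameter both follow from this. -/
theorem PruferEq.comparison {q θ₁ θ₂ : ℝ → ℝ} {s l₁ l₂ : ℝ}
    (hq : IntervalIntegrable q volume 0 π) (h₁ : PruferEq q s l₁ θ₁) (h₂ : PruferEq q s l₂ θ₂) :
    ∃ R : ℝ → ℝ, IntervalIntegrable R volume 0 π ∧ (∀ x, |R x| ≤ |s - (l₁ - q x) / s|) ∧
      ACD (fun x => θ₂ x - θ₁ x)
        fun x => R x * (θ₂ x - θ₁ x) + (l₂ - l₁) / s * cos (θ₂ x) ^ 2 := by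
  have hc₁ := h₁.continuousOn
  have hc₂ := h₂.continuousOn
  refine ⟨fun x => (s - (l₁ - q x) / s) * (sin (θ₂ x + θ₁ x) * sinc (θ₂ x - θ₁ x)), ?_, ?_, ?_⟩
  · exact intervalIntegrable_mul_continuousOn
      (intervalIntegrable_const.sub ((intervalIntegrable_const.sub hq).div_const s))
      ((continuous_sin.comp_continuousOn (hc₂.add hc₁)).mul
        (continuous_sinc.comp_continuousOn (hc₂.sub hc₁)))
  · intro x
    rw [abs_mul, abs_mul]
    refine mul_le_of_le_one_right (abs_nonneg _) ?_
    exact mul_le_one₀ (abs_sin_le_one _) (abs_nonneg _) (abs_sinc_le_one _)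
  · refine (ACD.sub h₂ h₁).congr_deriv fun x _ => ?_
    rw [mul_assoc, mul_assoc, ← sin_eq_sinc_mul, sin_add, sin_sub]
    linear_combination ((s - (l₁ - q x) / s) * sin (θ₁ x) ^ 2 + (l₁ - q x) / s) *
      sin_sq_add_cos_sq (θ₂ x) - ((s - (l₁ - q x) / s) * sin (θ₂ x) ^ 2 + (l₁ - q x) / s) *
      sin_sq_add_cos_sq (θ₁ x)

theorem PruferEq.lt {q θ₁ θ₂ : ℝ → ℝ} {s l₁ l₂ : ℝ}
    (hq : IntervalIntegrable q volume 0 π) (h₁ : PruferEq q s l₁ θ₁) (h₂ : PruferEq q s l₂ θ₂)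
    (hs : 0 < s) (hl : l₁ < l₂) (h0 : θ₁ 0 = θ₂ 0) (hcos : cos (θ₂ 0) ≠ 0) :
    θ₁ π < θ₂ π := by
  obtain ⟨R, hR, -, hd⟩ := h₁.comparison hq h₂
  have e := hd.linear_ode hR pi_mem
  rw [← sub_pos, e, h0, sub_self, zero_add]
  have hsl : 0 < (l₂ - l₁) / s := div_pos (sub_pos.2 hl) hs
  refine mul_pos (Real.exp_pos _) (intervalIntegral.integral_pos pi_pos ?_ (fun x _ => ?_)
    ⟨0, zero_mem, ?_⟩)
  · exact (Real.continuous_exp.comp_continuousOn (ACD.of_integral hR).continuousOn.neg).mul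
      (continuousOn_const.mul ((continuous_cos.comp_continuousOn h₂.continuousOn).pow 2))
  · positivity
  · have := Real.exp_pos (-∫ s in (0 : ℝ)..0, R s)
    have : 0 < cos (θ₂ 0) ^ 2 := by positivity
    positivity

/-- The constant involves l₁ but not l₂, so the bound gives continuity of θ(π) at l₁. -/
theorem PruferEq.abs_sub_le {q θ₁ θ₂ : ℝ → ℝ} {s l₁ l₂ : ℝ}
    (hq : IntervalIntegrable q volume 0 π) (h₁ : PruferEq q s l₁ θ₁) (h₂ : PruferEq q s l₂ θ₂)
    (hs : 0 < s) (h0 : θ₁ 0 = θ₂ 0) :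
    |θ₂ π - θ₁ π| ≤ exp (2 * ∫ t in (0 : ℝ)..π, |s - (l₁ - q t) / s|) * (π / s) * |l₂ - l₁| := by
  obtain ⟨R, hR, hRb, hd⟩ := h₁.comparison hq h₂
  have e := hd.linear_ode hR pi_mem
  set B := ∫ t in (0 : ℝ)..π, |s - (l₁ - q t) / s| with hB
  have hBi : IntervalIntegrable (fun t => |s - (l₁ - q t) / s|) volume 0 π :=
    (intervalIntegrable_const.sub ((intervalIntegrable_const.sub hq).div_const s)).abs
  have hRB : ∀ x ∈ Icc 0 π, |∫ t in (0 : ℝ)..x, R t| ≤ B := fun x hx =>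
    abs_integral_le_of_abs_le hBi (fun t _ => hRb t) hx
  rw [e, h0, sub_self, zero_add, abs_mul, abs_of_pos (Real.exp_pos _)]
  have h3 : |∫ t in (0 : ℝ)..π, exp (-∫ s in (0 : ℝ)..t, R s) * ((l₂ - l₁) / s * cos (θ₂ t) ^ 2)| ≤
      exp B * (|l₂ - l₁| / s) * |π - 0| := by
    rw [← Real.norm_eq_abs]
    refine intervalIntegral.norm_integral_le_of_norm_le_const fun t ht => ?_
    rw [uIoc_of_le pi_pos.le] at ht
    rw [Real.norm_eq_abs, abs_mul, abs_mul, abs_of_pos (Real.exp_pos _), abs_div, abs_of_pos hs]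
    have h4 : |cos (θ₂ t) ^ 2| ≤ 1 := by rw [abs_pow, sq_abs]; exact cos_sq_le_one _
    have h5 := (neg_le_abs _).trans (hRB t (Ioc_subset_Icc_self ht))
    gcongr
    exact mul_le_of_le_one_right (by positivity) h4
  rw [sub_zero, abs_of_pos pi_pos] at h3
  calc _ ≤ exp B * (exp B * (|l₂ - l₁| / s) * π) := by
        gcongr
        exact (le_abs_self _).trans (hRB π pi_mem)
    _ = exp (2 * B) * (π / s) * |l₂ - l₁| := by
        rw [two_mul, Real.exp_add]; ring

theorem abs_arctan_le (t : ℝ) : |arctan t| ≤ |t| := by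
  have key : ∀ t : ℝ, 0 ≤ t → arctan t ≤ t := fun t ht => by
    have := le_tan (arctan_nonneg.2 ht) (arctan_lt_pi_div_two t)
    rwa [tan_arctan] at this
  rcases le_total 0 t with h | h
  · rw [abs_of_nonneg (arctan_nonneg.2 h), abs_of_nonneg h]
    exact key t h
  · have h1 := key (-t) (by linarith)
    have h2 := arctan_nonneg.2 (by linarith : 0 ≤ -t)
    rw [arctan_neg] at h1 h2
    rw [abs_of_nonpos (by linarith), abs_of_nonpos h]
    exact h1

/-- The second hypothesis makes cos 2d positive and cos d + H sin d of the sign of cos d; the a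
priori bound |d| < 3π/4 selects the branch |d| < π/4. Up to the factor cos(arctan H), cos(d - arctan
H) equals cos d + H sin d. -/
theorem abs_sub_arctan_lt {d H : ℝ} (hdb : |d| < 3 * π / 4)
    (hlarge : (|H| + 1) * |sin d| < |cos d|) : |d - arctan H| < π / 2 := by
  have hd4 : |2 * d| < π / 2 := by
    refine abs_lt_of_cos_pos ?_ ?_
    · rw [cos_two_mul']
      have : |sin d| < |cos d| := by nlinarith [abs_nonneg (sin d), abs_nonneg H]
      have := sq_lt_sq.2 this
      linarith
    · rw [abs_mul, abs_two]; linarith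
  have hd4' : |d| < π / 4 := by rw [abs_mul, abs_two] at hd4; linarith
  have hcd : 0 < cos d := cos_pos_of_mem_Ioo
    ⟨by linarith [(abs_lt.1 hd4').1, pi_pos], by linarith [(abs_lt.1 hd4').2, pi_pos]⟩
  have hcH := cos_arctan_pos H
  refine abs_lt_of_cos_pos ?_ ?_
  · have htan : sin (arctan H) = H * cos (arctan H) := by
      rw [← tan_mul_cos hcH.ne', tan_arctan]
    have e : cos (d - arctan H) = cos (arctan H) * (cos d + H * sin d) := by
      rw [cos_sub, htan]; ring
    rw [e]
    refine mul_pos hcH ?_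
    have h1 : |H * sin d| ≤ (|H| + 1) * |sin d| := by
      rw [abs_mul]; nlinarith [abs_nonneg (sin d)]
    rw [abs_of_pos hcd] at hlarge
    have := neg_abs_le (H * sin d)
    linarith
  · have h1 := arctan_lt_pi_div_two H
    have h2 := neg_pi_div_two_lt_arctan H
    have h3 := abs_lt.1 hd4'
    rw [abs_lt]
    constructor <;> linarith

/-- The Prüfer angle with scale `r` for the spectral parameter `r ^ 2`. -/
theorem PruferEq.abs_sub_le_quarter {q η : ℝ → ℝ} {r h : ℝ} (hq : IntervalIntegrable q volume 0 π)
    (hη : PruferEq q r (r ^ 2) η) (hr0 : 0 < r) (hη0 : η 0 = -arctan (h / r))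
    (hr : 4 * (|h| + ∫ t in (0 : ℝ)..π, |q t|) ≤ r) : |η π - r * π| ≤ π / 4 := by
  have e := hη.integral_eq_sub pi_mem
  have hi : IntervalIntegrable (fun x => r⁻¹ * (q x * cos (η x) ^ 2)) volume 0 π :=
    (intervalIntegrable_mul_continuousOn hq
      ((continuous_cos.comp_continuousOn hη.continuousOn).pow 2)).const_mul _
  -- At scale r and parameter r² the Prüfer equation collapses to η' = r - (q / r) cos² η.
  have e2 : ∫ x in (0 : ℝ)..π, (r * sin (η x) ^ 2 + (r ^ 2 - q x) / r * cos (η x) ^ 2) =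
      r * π - ∫ x in (0 : ℝ)..π, r⁻¹ * (q x * cos (η x) ^ 2) := by
    have : r * π = ∫ x in (0 : ℝ)..π, r := by simp [mul_comm]
    rw [this, ← intervalIntegral.integral_sub intervalIntegrable_const hi]
    refine intervalIntegral.integral_congr fun x _ => ?_
    field_simp
    linear_combination r ^ 2 * sin_sq_add_cos_sq (η x)
  have e3 := abs_integral_le_mul (f := fun x => r⁻¹ * (q x * cos (η x) ^ 2)) (M := r⁻¹) hq
    (fun t _ => by
      rw [abs_mul, abs_mul, abs_of_pos (inv_pos.2 hr0), mul_comm, abs_pow, sq_abs]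
      gcongr
      exact mul_le_of_le_one_right (abs_nonneg _) (cos_sq_le_one _)) pi_mem
  have e4 : |η 0| ≤ |h| * r⁻¹ := by
    rw [hη0, abs_neg]
    refine (abs_arctan_le _).trans_eq ?_
    rw [abs_div, abs_of_pos hr0, div_eq_mul_inv]
  have e5 : (|h| + (∫ t in (0 : ℝ)..π, |q t|)) * r⁻¹ ≤ 1 / 4 := by
    rw [← div_eq_mul_inv, div_le_iff₀ hr0]; linarith
  rw [e2] at e
  have e6 : η π - r * π = η 0 - ∫ x in (0 : ℝ)..π, r⁻¹ * (q x * cos (η x) ^ 2) := by linarith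
  rw [e6]
  refine (abs_sub _ _).trans ?_
  nlinarith [pi_gt_three]

/-- The cosine of the difference is a positive multiple of s r y² + z², so angles of different
scales never drift apart by π/2. The count of half turns at scale r, where the asymptotics are
simple, thus passes to the fixed scale s. -/
theorem RealSol.abs_prufer_sub_lt {q y z θ η A B : ℝ → ℝ} {l h s r : ℝ}
    (hq : IntervalIntegrable q volume 0 π) (hy : RealSol q l y z) (hy0 : y 0 = 1)
    (hs : 0 < s) (hr : 0 < r) (hθ : ContinuousOn θ (Icc 0 π)) (hη : ContinuousOn η (Icc 0 π))
    (hθ0 : θ 0 = -arctan (h / s)) (hη0 : η 0 = -arctan (h / r))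
    (hA : ∀ x ∈ Icc 0 π, 0 < A x ∧ y x = A x * cos (θ x) ∧ z x = -(s * (A x * sin (θ x))))
    (hB : ∀ x ∈ Icc 0 π, 0 < B x ∧ y x = B x * cos (η x) ∧ z x = -(r * (B x * sin (η x)))) :
    |θ π - η π| < π / 2 := by
  refine abs_lt_of_cos_pos_on (f := fun x => θ x - η x) (hθ.sub hη) (fun x hx => ?_) ?_ pi_mem
  · obtain ⟨ha, hYa, hZa⟩ := hA x hx
    obtain ⟨hb, hYb, hZb⟩ := hB x hx
    have hpos := hy.energy_pos hq (Or.inl (by rw [hy0]; exact one_ne_zero)) hx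
    have e : s * r * (A x * B x * cos (θ x - η x)) = s * r * (y x * y x) + z x * z x := by
      rw [cos_sub]
      calc _ = s * r * ((A x * cos (θ x)) * (B x * cos (η x))) +
            (-(s * (A x * sin (θ x)))) * (-(r * (B x * sin (η x)))) := by ring
        _ = _ := by rw [← hYa, ← hZa, ← hYb, ← hZb]
    have hsr : 0 < s * r := mul_pos hs hr
    have h1 : 0 < s * r * (y x * y x) + z x * z x := by
      rcases eq_or_ne (y x) 0 with h0 | h0
      · simpa [h0] using hpos
      · have := mul_pos hsr (mul_self_pos.2 h0)
        linarith [mul_self_nonneg (z x)]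
    rw [← e] at h1
    exact pos_of_mul_pos_right (pos_of_mul_pos_right h1 hsr.le) (mul_pos ha hb).le
  · rw [hθ0, hη0, abs_lt]
    have := arctan_lt_pi_div_two (h / s)
    have := neg_pi_div_two_lt_arctan (h / s)
    have := arctan_lt_pi_div_two (h / r)
    have := neg_pi_div_two_lt_arctan (h / r)
    constructor <;> linarith

/-! ### Enumeration and localization of the eigenvalues -/

/-- A family of solutions of `-y'' + q y = l y` normalized by `y(0) = 1`, `y'(0) = h`. -/
structure SolFamily (q : ℝ → ℝ) (h : ℝ) (y z : ℝ → ℝ → ℝ) : Prop where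
  sol : ∀ l, RealSol q l (y l) (z l)
  fst_zero : ∀ l, y l 0 = 1
  snd_zero : ∀ l, z l 0 = h
  fst_cont : ∀ l, Continuous (y l)
  snd_cont : ∀ l, Continuous (z l)

theorem SolFamily.exists {q : ℝ → ℝ} (hq : IntervalIntegrable q volume 0 π) (h : ℝ) :
    ∃ y z, SolFamily q h y z := by
  choose y z h1 h2 h3 h4 h5 using fun l => RealSol.exists hq l 1 h
  exact ⟨y, z, h3, h4, h5, h1, h2⟩

namespace SolFamily

variable {q : ℝ → ℝ} {h : ℝ} {y z : ℝ → ℝ → ℝ}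

theorem eventually_pos (hq : IntervalIntegrable q volume 0 π) (hy : SolFamily q h y z) :
    ∀ᶠ k : ℝ in atTop, ∀ x ∈ Icc 0 π, 0 < y (-k ^ 2) x := by
  filter_upwards [eventually_ge_atTop 1,
    eventually_ge_atTop (4 * (|h| + 2 * (∫ t in (0 : ℝ)..π, |q t|) * (1 + |h|)))] with k h1 h2
  exact ((hy.sol _).hyperbolic_asymptotics hq (hy.fst_zero _) (hy.snd_zero _) h1 h2).1

theorem tendsto_log_deriv (hq : IntervalIntegrable q volume 0 π) (hy : SolFamily q h y z) :
    Tendsto (fun k : ℝ => z (-k ^ 2) π / y (-k ^ 2) π - k) atTop (𝓝 0) := by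
  have h0 : Tendsto (fun k : ℝ => 4 * (exp (-(2 * k * π)) * (|h| + k) +
      2 * (1 + |h|) * ∫ t in (0 : ℝ)..π, exp (-(2 * k * (π - t))) * |q t|)) atTop (𝓝 0) := by
    simpa using ((tendsto_exp_mul_add |h|).add
      ((tendsto_integral_exp_mul hq).const_mul (2 * (1 + |h|)))).const_mul 4
  refine squeeze_zero_norm' ?_ h0
  filter_upwards [eventually_ge_atTop 1,
    eventually_ge_atTop (4 * (|h| + 2 * (∫ t in (0 : ℝ)..π, |q t|) * (1 + |h|)))] with k h1 h2
  exact ((hy.sol _).hyperbolic_asymptotics hq (hy.fst_zero _) (hy.snd_zero _) h1 h2).2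

/-- For l = -k² with k large the solution is positive, so θ stays within (-π/2, π/2), and tan θ(π) =
-z(π)/y(π) is close to -k, hence below H. This makes the level of index 0 attainable. -/
theorem prufer_lower (hq : IntervalIntegrable q volume 0 π) (hy : SolFamily q h y z) (H : ℝ) :
    ∃ l, ∀ θ A : ℝ → ℝ, PruferEq q 1 l θ → |θ 0| < π →
      (∀ x ∈ Icc 0 π, 0 < A x ∧ y l x = A x * cos (θ x) ∧ z l x = -(1 * (A x * sin (θ x)))) →
      θ π < arctan H := by
  have h1 := (hy.tendsto_log_deriv hq).eventually (lt_mem_nhds (by norm_num : (-1 : ℝ) < 0))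
  obtain ⟨k, hpos, hk, hkH⟩ := ((hy.eventually_pos hq).and
    (h1.and (eventually_ge_atTop (1 - H)))).exists
  refine ⟨-k ^ 2, fun θ A hθ h0 hA => ?_⟩
  have hcos : ∀ x ∈ Icc 0 π, 0 < cos (θ x) := fun x hx => by
    obtain ⟨ha, hb, -⟩ := hA x hx
    have := hpos x hx
    rw [hb] at this
    exact pos_of_mul_pos_right this ha.le
  have hθb := abs_lt.1 (abs_lt_of_cos_pos_on hθ.continuousOn hcos h0 pi_mem)
  obtain ⟨ha, hb, hc⟩ := hA π pi_mem
  have hcπ := hcos π pi_mem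
  have htan : z (-k ^ 2) π / y (-k ^ 2) π = -tan (θ π) := by
    rw [hb, hc, tan_eq_sin_div_cos]
    field_simp
  rw [htan] at hk
  have hlt : tan (θ π) < H := by linarith
  have := arctan_strictMono hlt
  rwa [arctan_tan hθb.1 hθb.2] at this

/-- At r = N + 1/2 one has |sin rπ| = 1, so |z(π)| is of order r while y(π) stays bounded. The angle
therefore lies strictly between the levels of indices N and N + 1. -/
theorem prufer_upper (hq : IntervalIntegrable q volume 0 π) (hy : SolFamily q h y z) (H : ℝ) :
    ∃ N₀ : ℕ, ∀ N ≥ N₀, ∀ θ A : ℝ → ℝ, PruferEq q 1 (((N : ℝ) + 1 / 2) ^ 2) θ →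
      θ 0 = -arctan h →
      (∀ x ∈ Icc 0 π, 0 < A x ∧ y (((N : ℝ) + 1 / 2) ^ 2) x = A x * cos (θ x) ∧
        z (((N : ℝ) + 1 / 2) ^ 2) x = -(1 * (A x * sin (θ x)))) →
      arctan H + N * π < θ π ∧ θ π < arctan H + (N + 1) * π := by
  set Q := ∫ t in (0 : ℝ)..π, |q t| with hQ
  set C := |h| + 4 * Q * (1 + |h|) with hC
  obtain ⟨N₀, hN₀⟩ := exists_nat_ge (1 + 4 * Q + 4 * (|h| + Q) + C + (|H| + 1) * (2 * (1 + |h|)))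
  refine ⟨N₀, fun N hN θ A hθ hθ0 hA => ?_⟩
  have hQ0 : 0 ≤ Q := integral_abs_nonneg q
  have hC0 : 0 ≤ C := by positivity
  have hNr : (N₀ : ℝ) ≤ N := by exact_mod_cast hN
  have hprod : 0 ≤ (|H| + 1) * (2 * (1 + |h|)) := by positivity
  have hh0 := abs_nonneg h
  set r : ℝ := (N : ℝ) + 1 / 2 with hr
  have hr0 : 0 < r := by linarith
  set Y := y (r ^ 2) with hY
  set Z := z (r ^ 2) with hZ
  obtain ⟨hYb, -, hZb⟩ := (hy.sol (r ^ 2)).trig_asymptotics hq (hy.fst_zero _) (hy.snd_zero _)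
    (by linarith) (by linarith) pi_mem
  obtain ⟨η, B, hη, hη0, hB⟩ := (hy.sol (r ^ 2)).exists_prufer hq (hy.fst_zero _) (hy.snd_zero _) hr0
  have hηπ := hη.abs_sub_le_quarter hq hr0 hη0 (by linarith)
  have hclose := (hy.sol (r ^ 2)).abs_prufer_sub_lt hq (hy.fst_zero _) one_pos hr0
    hθ.continuousOn hη.continuousOn (by simpa using hθ0) hη0 hA hB
  obtain ⟨ha, hYa, hZa⟩ := hA π pi_mem
  set d := θ π - r * π with hd
  have hdb : |d| < 3 * π / 4 := by
    have : d = (θ π - η π) + (η π - r * π) := by simp only [hd]; ring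
    rw [this]
    exact (abs_add_le _ _).trans_lt (by linarith)
  have hθd : θ π = (d + π / 2) + N * π := by simp only [hd, hr]; ring
  have hsin : |sin (θ π)| = |cos d| := by
    rw [hθd, sin_add_nat_mul_pi, sin_add_pi_div_two, abs_mul, abs_pow, abs_neg, abs_one, one_pow,
      one_mul]
  have hcos : |cos (θ π)| = |sin d| := by
    rw [hθd, cos_add_nat_mul_pi, cos_add_pi_div_two, abs_mul, abs_pow, abs_neg, abs_one, one_pow,
      one_mul, abs_neg]
  have hsr : |sin (r * π)| = 1 := by
    have : r * π = π / 2 + N * π := by simp only [hr]; ring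
    rw [this, sin_add_nat_mul_pi, sin_pi_div_two, mul_one, abs_pow, abs_neg, abs_one, one_pow]
  have hZlow : r - C ≤ |Z π| := by
    have h1 := abs_sub_abs_le_abs_sub (-(r * sin (r * π))) (Z π)
    rw [abs_neg, abs_mul, hsr, abs_of_pos hr0, ← abs_neg (-(r * sin (r * π)) - Z π)] at h1
    have e : -(-(r * sin (r * π)) - Z π) = Z π + r * sin (r * π) := by ring
    rw [e] at h1
    linarith
  have hlarge : (|H| + 1) * |sin d| < |cos d| := by
    have h1 : (|H| + 1) * |Y π| < |Z π| := by
      refine lt_of_le_of_lt (mul_le_mul_of_nonneg_left hYb (by positivity)) ?_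
      linarith
    have h2 : |Y π| = A π * |sin d| := by rw [hYa, abs_mul, abs_of_pos ha, hcos]
    have h3 : |Z π| = A π * |cos d| := by
      rw [hZa, one_mul, abs_neg, abs_mul, abs_of_pos ha, hsin]
    rw [h2, h3] at h1
    exact lt_of_mul_lt_mul_left (by linarith) ha.le
  have hfin := abs_sub_arctan_lt hdb hlarge
  have h1 := abs_lt.1 hfin
  rw [hθd]
  constructor <;> linarith

/-- Existence, enumeration and localization of the eigenvalues. -/
theorem exists_eigenvalues (hq : IntervalIntegrable q volume 0 π) (hy : SolFamily q h y z) (H : ℝ) :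
    ∃ μ : ℕ → ℝ, StrictMono μ ∧ (∀ l, z l π + H * y l π = 0 ↔ ∃ n, μ n = l) ∧
      ∃ N₀ : ℕ, ∀ n ≥ N₀, ((n : ℝ) - 1 / 2) ^ 2 < μ n ∧ μ n < ((n : ℝ) + 1 / 2) ^ 2 := by
  choose θ A hθ hθ0 hA using fun l =>
    (hy.sol l).exists_prufer hq (hy.fst_zero l) (hy.snd_zero l) one_pos
  simp only [div_one] at hθ0
  have hat1 := arctan_lt_pi_div_two h
  have hat2 := neg_pi_div_two_lt_arctan h
  have hmono : StrictMono fun l => θ l π := fun l₁ l₂ hl =>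
    (hθ l₁).lt hq (hθ l₂) one_pos hl (by rw [hθ0, hθ0]) (by
      rw [hθ0, cos_neg]; exact (cos_arctan_pos h).ne')
  have hcont : Continuous fun l => θ l π := by
    rw [continuous_iff_continuousAt]
    intro l
    rw [ContinuousAt, tendsto_iff_norm_sub_tendsto_zero]
    refine squeeze_zero (fun _ => norm_nonneg _)
      (fun l' => (hθ l).abs_sub_le hq (hθ l') one_pos (by rw [hθ0, hθ0])) ?_
    have : Tendsto (fun l' : ℝ => |l' - l|) (𝓝 l) (𝓝 0) := by
      have : ContinuousAt (fun l' : ℝ => |l' - l|) l := by fun_prop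
      simpa [ContinuousAt] using this
    simpa using this.const_mul _
  have hlow : ∀ l, -(π / 2) < θ l π := fun l =>
    (hθ l).neg_pi_div_two_lt hq one_pos (by rw [hθ0]; linarith) pi_mem
  obtain ⟨l₀, hl₀⟩ := hy.prufer_lower hq H
  have hl₀ := hl₀ (θ l₀) (A l₀) (hθ l₀) (by
    rw [hθ0, abs_neg, abs_lt]; constructor <;> linarith [pi_pos]) (hA l₀)
  obtain ⟨N₀, hN₀⟩ := hy.prufer_upper hq H
  have hup : ∀ N ≥ N₀, arctan H + N * π < θ (((N : ℝ) + 1 / 2) ^ 2) π ∧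
      θ (((N : ℝ) + 1 / 2) ^ 2) π < arctan H + (N + 1) * π := fun N hN =>
    hN₀ N hN _ (A _) (hθ _) (hθ0 _) (hA _)
  have hex : ∀ n : ℕ, ∃ l, θ l π = arctan H + n * π := by
    intro n
    have h1 := (hup (max n N₀) (le_max_right _ _)).1
    have h2 : (n : ℝ) * π ≤ (max n N₀ : ℕ) * π := by
      have : (n : ℝ) ≤ (max n N₀ : ℕ) := by exact_mod_cast le_max_left _ _
      exact mul_le_mul_of_nonneg_right this pi_pos.le
    have h3 : (0 : ℝ) ≤ n * π := by positivity
    exact mem_range_of_exists_le_of_exists_ge hcont ⟨l₀, by linarith⟩ ⟨_, (by linarith : _ ≤ _)⟩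
  choose μ hμ using hex
  refine ⟨μ, fun m n hmn => ?_, fun l => ?_, N₀ + 1, fun n hn => ?_⟩
  · rw [← hmono.lt_iff_lt]
    rw [hμ, hμ]
    have : (m : ℝ) < n := by exact_mod_cast hmn
    nlinarith [pi_pos]
  · obtain ⟨ha, hb, hc⟩ := hA l π pi_mem
    have hcH := cos_arctan_pos H
    have htan : sin (arctan H) = H * cos (arctan H) := by
      rw [← tan_mul_cos hcH.ne', tan_arctan]
    have e : z l π + H * y l π = 0 ↔ sin (θ l π - arctan H) = 0 := by
      rw [sin_sub, htan, hb, hc]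
      have e1 : sin (θ l π) * cos (arctan H) - cos (θ l π) * (H * cos (arctan H)) =
        cos (arctan H) * (sin (θ l π) - H * cos (θ l π)) := by ring
      have e2 : -(1 * (A l π * sin (θ l π))) + H * (A l π * cos (θ l π)) =
        -A l π * (sin (θ l π) - H * cos (θ l π)) := by ring
      rw [e1, e2, mul_eq_zero, mul_eq_zero]
      simp [ha.ne', hcH.ne']
    rw [e, sin_eq_zero_iff]
    constructor
    · rintro ⟨k, hk⟩
      -- From θ(π) > -π/2 and arctan H < π/2 the integer exceeds -1.
      have h1 := hlow l
      have h2 := arctan_lt_pi_div_two H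
      have h3 : (-1 : ℝ) * π < k * π := by linarith
      have h4 : (-1 : ℝ) < k := lt_of_mul_lt_mul_right h3 pi_pos.le
      have h5 : 0 ≤ k := by
        have : (-1 : ℤ) < k := by exact_mod_cast h4
        omega
      obtain ⟨n, rfl⟩ := Int.eq_ofNat_of_zero_le h5
      refine ⟨n, hmono.injective ?_⟩
      rw [hμ]
      push_cast at hk
      linarith
    · rintro ⟨n, rfl⟩
      exact ⟨n, by rw [hμ]; push_cast; ring⟩
  · constructor
    -- The lower bound uses the bracket for n - 1, hence the threshold `N₀ + 1`.
    · have h1 := (hup (n - 1) (by omega)).2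
      have h2 : ((n - 1 : ℕ) : ℝ) = n - 1 := by
        rw [Nat.cast_sub (by omega)]; simp
      rw [h2, sub_add_cancel, ← hμ n] at h1
      have := hmono.lt_iff_lt.1 h1
      have e : (n : ℝ) - 1 + 1 / 2 = n - 1 / 2 := by ring
      rwa [e] at this
    · have h1 := (hup n (by omega)).1
      rw [← hμ n] at h1
      exact hmono.lt_iff_lt.1 h1

end SolFamily

/-! ### Asymptotics of eigenvalues, eigenfunctions and norming constants -/

/-- The sine coefficients that govern the asymptotics of the norming constants. -/
noncomputable def sineCoeff (q : ℝ → ℝ) (n : ℕ) : ℝ := ∫ x in (0 : ℝ)..π, (π - x) * q x * sin (2 * n * x)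

/-- The condition at π bounds r |sin rπ|, which pins r to within C/r of n. Then y z = -(r/2) sin 2nx
+ O(1), and inserting this in `RealSol.integral_sq` leaves the sine coefficient over 2r and an
O(1/r²) remainder. -/
theorem RealSol.eigen_asymptotics {q y z : ℝ → ℝ} {r h H : ℝ} {n : ℕ}
    (hq : IntervalIntegrable q volume 0 π) (hy : RealSol q (r ^ 2) y z) (hy0 : y 0 = 1)
    (hz0 : z 0 = h) (hH : z π + H * y π = 0) (hr1 : 1 ≤ r)
    (hr : 4 * (∫ t in (0 : ℝ)..π, |q t|) ≤ r) (hn : |r - n| < 1 / 2)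
    {Q M B C D E : ℝ} (hQ : Q = ∫ t in (0 : ℝ)..π, |q t|) (hM : M = 2 * (1 + |h|))
    (hB : B = |h| + 4 * Q * (1 + |h|)) (hC : C = B + |H| * M)
    (hD : D = M * B + B + π * C) (hE : E = π * h ^ 2 + |h| + |H| * M ^ 2 + Q * M ^ 2 + 2 * π * Q * D) :
    |r - n| ≤ C / r ∧ (∀ x ∈ Icc 0 π, |y x - cos (n * x)| ≤ (B + π * C) / r) ∧
      |(∫ x in (0 : ℝ)..π, y x ^ 2) - π / 2| ≤ |sineCoeff q n| / (2 * r) + E / (2 * r ^ 2) := by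
  have hr0 : 0 < r := by linarith
  have hQ0 : 0 ≤ Q := hQ ▸ integral_abs_nonneg q
  have hM0 : 0 ≤ M := by rw [hM]; positivity
  have hB0 : 0 ≤ B := by rw [hB]; positivity
  have hC0 : 0 ≤ C := by rw [hC]; positivity
  have hD0 : 0 ≤ D := by rw [hD]; positivity
  have hbase : ∀ x ∈ Icc 0 π, |y x| ≤ M ∧ |y x - cos (r * x)| ≤ B / r ∧
      |z x + r * sin (r * x)| ≤ B := fun x hx => by
    rw [hM, hB, hQ]
    exact hy.trig_asymptotics hq hy0 hz0 hr1 hr hx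
  have hrn : |r - n| ≤ C / r := by
    obtain ⟨h1, -, h3⟩ := hbase π pi_mem
    have h4 : r * |sin (r * π)| ≤ C := by
      have e : r * sin (r * π) = (z π + r * sin (r * π)) + H * y π := by linarith
      rw [← abs_of_pos hr0, ← abs_mul, abs_of_pos hr0, e, hC]
      refine (abs_add_le _ _).trans ?_
      rw [abs_mul]
      gcongr
    have h5 : |sin (r * π)| = |sin ((r - n) * π)| := by
      rw [sub_mul, sin_sub_nat_mul_pi, abs_mul, abs_pow, abs_neg, abs_one, one_pow, one_mul]
    -- Jordan's inequality is available because |r - n| < 1/2.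
    have h6 : 2 / π * |(r - n) * π| ≤ |sin ((r - n) * π)| := mul_abs_le_abs_sin (by
      rw [abs_mul, abs_of_pos pi_pos]; nlinarith [pi_pos])
    rw [abs_mul, abs_of_pos pi_pos] at h6
    have h7 : 2 / π * (|r - n| * π) = 2 * |r - n| := by field_simp
    rw [le_div_iff₀ hr0]
    nlinarith [abs_nonneg (r - n)]
  have hx_mul : ∀ x ∈ Icc 0 π, |(r - n) * x| ≤ π * (C / r) := fun x hx => by
    rw [abs_mul, abs_of_nonneg hx.1, mul_comm]
    have := hx.2
    have := hx.1
    gcongr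
  refine ⟨hrn, fun x hx => ?_, ?_⟩
  · have h1 := (hbase x hx).2.1
    have h2 := (abs_cos_sub_cos_le (r * x) (n * x)).trans
      ((by rw [← sub_mul] : |r * x - n * x| = |(r - n) * x|).le.trans (hx_mul x hx))
    calc |y x - cos (n * x)| ≤ |y x - cos (r * x)| + |cos (r * x) - cos (n * x)| :=
          abs_sub_le _ _ _
      _ ≤ B / r + π * (C / r) := add_le_add h1 h2
      _ = _ := by ring
  · have hyz : ∀ x ∈ Icc 0 π, |y x * z x + r / 2 * sin (2 * n * x)| ≤ D := by
      intro x hx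
      obtain ⟨h1, h2, h3⟩ := hbase x hx
      have e : y x * z x + r / 2 * sin (2 * n * x) = y x * (z x + r * sin (r * x)) -
          r * sin (r * x) * (y x - cos (r * x)) +
          r / 2 * (sin (2 * n * x) - sin (2 * (r * x))) := by
        rw [sin_two_mul (r * x)]; ring
      have h4 : |y x * (z x + r * sin (r * x))| ≤ M * B := by rw [abs_mul]; gcongr
      have h5 : |r * sin (r * x) * (y x - cos (r * x))| ≤ r * 1 * (B / r) := by
        rw [abs_mul, abs_mul, abs_of_pos hr0]
        gcongr
        exact abs_sin_le_one _
      have h6 : |r / 2 * (sin (2 * n * x) - sin (2 * (r * x)))| ≤ r / 2 * (2 * (π * (C / r))) := by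
        rw [abs_mul, abs_of_pos (by positivity : 0 < r / 2)]
        gcongr
        refine (abs_sin_sub_sin_le _ _).trans ?_
        have e : 2 * (n : ℝ) * x - 2 * (r * x) = -(2 * ((r - n) * x)) := by ring
        rw [e, abs_neg, abs_mul, abs_two]
        gcongr
        exact hx_mul x hx
      rw [e]
      refine (abs_add_le _ _).trans ?_
      have h7 := abs_sub (y x * (z x + r * sin (r * x))) (r * sin (r * x) * (y x - cos (r * x)))
      have e1 : r * 1 * (B / r) = B := by field_simp
      have e2 : r / 2 * (2 * (π * (C / r))) = π * C := by field_simp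
      rw [e1] at h5
      rw [e2] at h6
      rw [hD]
      linarith
    have hyc := hy.fst.continuousOn
    have hzc := hy.snd.continuousOn
    have hqx : IntervalIntegrable (fun x => (π - x) * q x) volume 0 π :=
      hq.continuousOn_mul (by fun_prop)
    have hi1 : IntervalIntegrable (fun x => (π - x) * q x * (y x * z x)) volume 0 π :=
      intervalIntegrable_mul_continuousOn hqx (hyc.mul hzc)
    have hi2 : IntervalIntegrable (fun x => (π - x) * q x * sin (2 * n * x)) volume 0 π :=
      intervalIntegrable_mul_continuousOn hqx (by fun_prop)
    have hJ : |(∫ x in (0 : ℝ)..π, (π - x) * q x * (y x * z x)) + r / 2 * sineCoeff q n| ≤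
        Q * (π * D) := by
      rw [sineCoeff, ← intervalIntegral.integral_const_mul,
        ← intervalIntegral.integral_add hi1 (hi2.const_mul _), hQ]
      refine abs_integral_le_mul hq (fun t ht => ?_) pi_mem
      have e : (π - t) * q t * (y t * z t) + r / 2 * ((π - t) * q t * sin (2 * n * t)) =
        q t * ((π - t) * (y t * z t + r / 2 * sin (2 * n * t))) := by ring
      rw [e, abs_mul, abs_mul]
      gcongr
      · rw [abs_of_nonneg (by linarith [ht.2])]; linarith [ht.1]
      · exact hyz t ht
    have hK : |∫ x in (0 : ℝ)..π, q x * y x ^ 2| ≤ Q * M ^ 2 := by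
      rw [hQ]
      refine abs_integral_le_mul hq (fun t ht => ?_) pi_mem
      rw [abs_mul, abs_pow]
      have := (hbase t ht).1
      gcongr
    have hend : |y π * z π| ≤ |H| * M ^ 2 := by
      have e : y π * z π = -(H * y π ^ 2) := by linear_combination y π * hH
      rw [e, abs_neg, abs_mul, abs_pow]
      have := (hbase π pi_mem).1
      gcongr
    have hmain := hy.integral_sq hq
    rw [hy0, hz0] at hmain
    set a := ∫ x in (0 : ℝ)..π, y x ^ 2 with ha
    have e : 2 * r ^ 2 * (a - π / 2) = -(r * sineCoeff q n) + (π * h ^ 2 + h - y π * z π +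
        (∫ x in (0 : ℝ)..π, q x * y x ^ 2) +
        2 * ((∫ x in (0 : ℝ)..π, (π - x) * q x * (y x * z x)) + r / 2 * sineCoeff q n)) := by
      linear_combination hmain
    have hpos : 0 < 2 * r ^ 2 := by positivity
    have h1 : 2 * r ^ 2 * |a - π / 2| ≤ r * |sineCoeff q n| + E := by
      have e' : 2 * r ^ 2 * |a - π / 2| = |2 * r ^ 2 * (a - π / 2)| := by
        rw [abs_mul, abs_of_pos hpos]
      rw [e', e]
      refine (abs_add_le _ _).trans (add_le_add ?_ ?_)
      · rw [abs_neg, abs_mul, abs_of_pos hr0]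
      · have b0 := abs_le.1 (le_refl |h|)
        have b1 := abs_le.1 hend
        have b2 := abs_le.1 hK
        have b3 := abs_le.1 hJ
        have b4 : 0 ≤ π * h ^ 2 := by positivity
        rw [hE, abs_le]
        constructor <;> linarith
    rw [div_add_div _ _ (by positivity) hpos.ne', le_div_iff₀ (by positivity)]
    nlinarith

/-- The eigenvalues and normalized eigenfunctions are asymptotically those of `q = 0`. -/
theorem SolFamily.eigen_asymptotics {q : ℝ → ℝ} {h H : ℝ} {y z : ℝ → ℝ → ℝ} {μ : ℕ → ℝ}
    (hq : IntervalIntegrable q volume 0 π) (hy : SolFamily q h y z)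
    (hμ : ∀ n, z (μ n) π + H * y (μ n) π = 0) {N₀ : ℕ}
    (hloc : ∀ n ≥ N₀, ((n : ℝ) - 1 / 2) ^ 2 < μ n ∧ μ n < ((n : ℝ) + 1 / 2) ^ 2) :
    ∃ C : ℝ, 0 ≤ C ∧ ∃ N : ℕ, 1 ≤ N ∧ ∀ n ≥ N, |μ n - (n : ℝ) ^ 2| ≤ C ∧
      (∀ x ∈ Icc 0 π, |y (μ n) x - cos (n * x)| ≤ C / n) ∧
      |(∫ x in (0 : ℝ)..π, y (μ n) x ^ 2) - π / 2| ≤ |sineCoeff q n| / n + C / (n : ℝ) ^ 2 := by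
  obtain ⟨Q, hQ⟩ : ∃ Q, Q = ∫ t in (0 : ℝ)..π, |q t| := ⟨_, rfl⟩
  obtain ⟨M, hM⟩ : ∃ M, M = 2 * (1 + |h|) := ⟨_, rfl⟩
  obtain ⟨B, hB⟩ : ∃ B, B = |h| + 4 * Q * (1 + |h|) := ⟨_, rfl⟩
  obtain ⟨C, hC⟩ : ∃ C, C = B + |H| * M := ⟨_, rfl⟩
  obtain ⟨D, hD⟩ : ∃ D, D = M * B + B + π * C := ⟨_, rfl⟩
  obtain ⟨E, hE⟩ : ∃ E, E = π * h ^ 2 + |h| + |H| * M ^ 2 + Q * M ^ 2 + 2 * π * Q * D := ⟨_, rfl⟩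
  have hQ0 : 0 ≤ Q := hQ ▸ integral_abs_nonneg q
  have hM0 : 0 ≤ M := by rw [hM]; positivity
  have hB0 : 0 ≤ B := by rw [hB]; positivity
  have hC0 : 0 ≤ C := by rw [hC]; positivity
  have hD0 : 0 ≤ D := by rw [hD]; positivity
  have hE0 : 0 ≤ E := by rw [hE]; positivity
  obtain ⟨N₁, hN₁⟩ := exists_nat_ge (2 + 4 * Q)
  refine ⟨3 * C + 2 * (B + π * C) + 2 * E, by positivity, max N₀ (max N₁ 1),
    (le_max_right _ _).trans (le_max_right _ _), fun n hn => ?_⟩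
  obtain ⟨hl1, hl2⟩ := hloc n ((le_max_left _ _).trans hn)
  have hnr : 2 + 4 * Q ≤ n := hN₁.trans (by
    exact_mod_cast ((le_max_left _ _).trans (le_max_right _ _)).trans hn)
  have hn0 : (0 : ℝ) < n := by linarith
  have hμ0 : 0 ≤ μ n := (sq_nonneg _).trans hl1.le
  obtain ⟨r, hrn⟩ : ∃ r, r = √(μ n) := ⟨_, rfl⟩
  have hr2 : μ n = r ^ 2 := by rw [hrn, sq_sqrt hμ0]
  have hr0 : 0 ≤ r := hrn ▸ sqrt_nonneg _
  rw [hr2] at hl1 hl2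
  have hlo : (n : ℝ) - 1 / 2 < r := lt_of_pow_lt_pow_left₀ 2 hr0 hl1
  have hhi : r < (n : ℝ) + 1 / 2 := lt_of_pow_lt_pow_left₀ 2 (by positivity) hl2
  have hm := hμ n
  rw [hr2] at hm ⊢
  obtain ⟨h1, h2, h3⟩ := (hy.sol (r ^ 2)).eigen_asymptotics (n := n) hq (hy.fst_zero _)
    (hy.snd_zero _) hm (by linarith) (by rw [← hQ]; linarith)
    (by rw [abs_lt]; constructor <;> linarith) hQ hM hB hC hD hE
  have hrpos : 0 < r := by linarith
  have hnr2 : (n : ℝ) ≤ 2 * r := by linarith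
  have hBC : 0 ≤ B + π * C := by positivity
  have hdiv : ∀ c : ℝ, 0 ≤ c → c / r ≤ 2 * c / n := fun c hc => by
    rw [div_le_div_iff₀ hrpos hn0]; nlinarith
  refine ⟨?_, fun x hx => ?_, ?_⟩
  · have e : r ^ 2 - (n : ℝ) ^ 2 = (r - n) * (r + n) := by ring
    rw [e, abs_mul, abs_of_pos (by linarith : 0 < r + n)]
    rw [le_div_iff₀ hrpos] at h1
    have : |r - n| * (r + n) ≤ 3 * (|r - n| * r) := by nlinarith [abs_nonneg (r - n)]
    linarith
  · refine ((h2 x hx).trans (hdiv _ hBC)).trans ?_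
    gcongr
    linarith
  · refine h3.trans (add_le_add ?_ ?_)
    · gcongr
    · rw [div_le_div_iff₀ (by positivity) (by positivity)]
      have : (n : ℝ) ^ 2 ≤ 4 * r ^ 2 := by nlinarith
      have h4 : 0 ≤ 3 * C + 2 * (B + π * C) := by positivity
      have h5 : 0 ≤ (3 * C + 2 * (B + π * C)) * (2 * r ^ 2) := by positivity
      have h6 := mul_le_mul_of_nonneg_left this hE0
      linarith

/-- `sineCoeff q n` is -π times the imaginary part of the n-th Fourier coefficient of (π - x) q on
an interval of length π, which accounts for the frequency 2n. Square summability is Parseval's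
identity; this is where q in L², rather than merely integrable, matters. -/
theorem summable_sineCoeff_sq {q : ℝ → ℝ} (hq : MemLp q 2 (volume.restrict (Icc 0 π))) :
    Summable fun n : ℕ => sineCoeff q n ^ 2 := by
  have hq' : MemLp q 2 (volume.restrict (Ioc 0 π)) :=
    hq.mono_measure (Measure.restrict_mono Ioc_subset_Icc_self le_rfl)
  have h0 : MemLp (fun x => (π - x) * q x) 2 (volume.restrict (Ioc 0 π)) := by
    refine hq'.of_le_mul (c := π) ?_ ?_
    · exact (by fun_prop : Continuous fun x : ℝ => π - x).aestronglyMeasurable.mul hq'.1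
    · refine (ae_restrict_iff' measurableSet_Ioc).2 (ae_of_all _ fun x hx => ?_)
      rw [norm_mul]
      gcongr
      rw [Real.norm_eq_abs, abs_of_nonneg (by linarith [hx.2])]
      linarith [hx.1]
  have h1 : MemLp (fun x => (((π - x) * q x : ℝ) : ℂ)) 2 (volume.restrict (Ioc 0 π)) := h0.ofReal
  have hs := (hasSum_sq_fourierCoeffOn pi_pos h1).summable
  have hs2 : Summable fun n : ℕ => π ^ 2 * ‖fourierCoeffOn pi_pos
      (fun x => (((π - x) * q x : ℝ) : ℂ)) (n : ℤ)‖ ^ 2 :=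
    (hs.comp_injective Nat.cast_injective).mul_left _
  refine Summable.of_nonneg_of_le (fun n => sq_nonneg _) (fun n => ?_) hs2
  have hint : IntervalIntegrable (fun x => (((π - x) * q x : ℝ) : ℂ)) volume 0 π := by
    rw [intervalIntegrable_iff_integrableOn_Ioc_of_le pi_pos.le]
    exact h1.integrable (by norm_num)
  have e : sineCoeff q n = -π * (fourierCoeffOn pi_pos
      (fun x => (((π - x) * q x : ℝ) : ℂ)) (n : ℤ)).im := by
    rw [fourierCoeffOn_eq_integral, Complex.smul_im]
    have e2 : (∫ x in (0 : ℝ)..π, fourier (-(n : ℤ)) (x : AddCircle (π - 0)) •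
        (((π - x) * q x : ℝ) : ℂ)).im = ∫ x in (0 : ℝ)..π, -((π - x) * q x * sin (2 * n * x)) := by
      rw [← Complex.imCLM_apply, ← ContinuousLinearMap.intervalIntegral_comp_comm]
      · refine intervalIntegral.integral_congr fun x _ => ?_
        have e3 : (2 * π * Complex.I * ((-(n : ℤ) : ℤ) : ℂ) * x / ((π - 0 : ℝ) : ℂ)) =
            ((-(2 * n * x) : ℝ) : ℂ) * Complex.I := by
          push_cast
          have : (π : ℂ) ≠ 0 := by exact_mod_cast pi_ne_zero
          field_simp
          simp
          ring
        rw [Complex.imCLM_apply, fourier_coe_apply, e3, smul_eq_mul, mul_comm,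
          Complex.im_ofReal_mul, Complex.exp_ofReal_mul_I_im, sin_neg]
        ring
      · simp only [smul_eq_mul]
        refine hint.continuousOn_mul (Continuous.continuousOn ?_)
        simp only [fourier_coe_apply]
        fun_prop
    rw [e2, intervalIntegral.integral_neg, sineCoeff, sub_zero]
    rw [smul_eq_mul, mul_neg, neg_mul_neg, ← mul_assoc, mul_one_div_cancel pi_ne_zero, one_mul]
  rw [e, mul_pow, neg_sq]
  gcongr ?_ * ?_
  rw [← sq_abs]
  gcongr
  exact Complex.abs_im_le_norm _

/-! ### Completeness of systems close to the cosines, and pointwise expansions -/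

theorem eq_zero_of_integral_sq_eq_zero {v : ℝ → ℝ} (hv : Continuous v)
    (h : ∫ x in (0 : ℝ)..π, v x ^ 2 = 0) {x : ℝ} (hx : x ∈ Icc 0 π) : v x = 0 := by
  by_contra hne
  have : 0 < ∫ x in (0 : ℝ)..π, v x ^ 2 :=
    intervalIntegral.integral_pos pi_pos (hv.pow 2).continuousOn (fun _ _ => sq_nonneg _)
      ⟨x, hx, by positivity⟩
  exact this.ne' h

theorem sq_integral_abs_le {v : ℝ → ℝ} (hv : Continuous v) :
    (∫ x in (0 : ℝ)..π, |v x|) ^ 2 ≤ π * ∫ x in (0 : ℝ)..π, v x ^ 2 := by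
  set I := ∫ x in (0 : ℝ)..π, |v x| with hI
  have h0 : 0 ≤ ∫ x in (0 : ℝ)..π, (π * |v x| - I) ^ 2 :=
    intervalIntegral.integral_nonneg pi_pos.le fun _ _ => sq_nonneg _
  have e : ∫ x in (0 : ℝ)..π, (π * |v x| - I) ^ 2 =
      ∫ x in (0 : ℝ)..π, (π ^ 2 * v x ^ 2 - 2 * π * I * |v x| + I ^ 2) := by
    congr 1; ext x; rw [← sq_abs (v x)]; ring
  have i1 : IntervalIntegrable (fun x => π ^ 2 * v x ^ 2) volume 0 π :=
    (by fun_prop : Continuous _).intervalIntegrable _ _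
  have i2 : IntervalIntegrable (fun x => 2 * π * I * |v x|) volume 0 π :=
    (by fun_prop : Continuous _).intervalIntegrable _ _
  rw [e, intervalIntegral.integral_add (i1.sub i2) intervalIntegrable_const,
    intervalIntegral.integral_sub i1 i2, intervalIntegral.integral_const_mul,
    intervalIntegral.integral_const_mul, ← hI, intervalIntegral.integral_const, sub_zero,
    smul_eq_mul] at h0
  have h1 : 0 ≤ π * (π * (∫ x in (0 : ℝ)..π, v x ^ 2) - I ^ 2) := by linarith
  have := nonneg_of_mul_nonneg_right h1 pi_pos
  linarith

/-- **Parseval's identity** for the cosine system on `[0, π]`. -/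
theorem hasSum_sq_cos_coeff {v : ℝ → ℝ} (hv : Continuous v) :
    HasSum (fun n : ℕ => 2 / π ^ 2 * (∫ x in (0 : ℝ)..π, v x * cos (n * x)) ^ 2)
      (1 / π * (∫ x in (0 : ℝ)..π, v x ^ 2) +
        1 / π ^ 2 * (∫ x in (0 : ℝ)..π, v x * cos ((0 : ℕ) * x)) ^ 2) := by
  -- The even extension to [-π, π] has only cosine coefficients.
  set f : ℝ → ℂ := fun x => (v |x| : ℂ) with hf
  have hfc : Continuous f := by fun_prop
  have hab : -π < π := by linarith [pi_pos]
  have hL2 : MemLp f 2 (volume.restrict (Ioc (-π) π)) := by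
    obtain ⟨K, hK⟩ := (isCompact_Icc (a := -π) (b := π)).exists_bound_of_continuousOn
      hfc.continuousOn
    exact MemLp.of_bound hfc.aestronglyMeasurable K ((ae_restrict_iff' measurableSet_Ioc).2
      (ae_of_all _ fun x hx => hK x (Ioc_subset_Icc_self hx)))
  have hsplit : ∀ g : ℝ → ℂ, Continuous g → ∫ x in (-π)..π, g x =
      ∫ x in (0 : ℝ)..π, (g x + g (-x)) := by
    intro g hg
    rw [← intervalIntegral.integral_add_adjacent_intervals (b := 0)
      (hg.intervalIntegrable _ _) (hg.intervalIntegrable _ _),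
      intervalIntegral.integral_add (hg.intervalIntegrable _ _)
      ((by fun_prop : Continuous fun x => g (-x)).intervalIntegrable _ _), add_comm]
    congr 1
    rw [intervalIntegral.integral_comp_neg, neg_zero]
  have hcoef : ∀ n : ℤ, fourierCoeffOn hab f n =
      ((1 / π * ∫ x in (0 : ℝ)..π, v x * cos (n * x) : ℝ) : ℂ) := by
    intro n
    have hexp : ∀ x : ℝ, fourier (-n) (x : AddCircle (π - -π)) =
        Complex.exp (((-(n * x) : ℝ) : ℂ) * Complex.I) := by
      intro x
      rw [fourier_coe_apply]
      congr 1
      push_cast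
      have : (π : ℂ) ≠ 0 := by exact_mod_cast pi_ne_zero
      field_simp
      ring
    rw [fourierCoeffOn_eq_integral, hsplit _ (by simp only [hexp]; fun_prop)]
    have e : ∀ x : ℝ, x ∈ uIcc 0 π → fourier (-n) (x : AddCircle (π - -π)) • f x +
        fourier (-n) ((-x : ℝ) : AddCircle (π - -π)) • f (-x) =
        ((2 * (v x * cos (n * x)) : ℝ) : ℂ) := by
      intro x hx
      rw [uIcc_zero_pi] at hx
      rw [hexp, hexp]
      simp only [hf, abs_neg, abs_of_nonneg hx.1, smul_eq_mul]
      rw [← add_mul, show -((n : ℝ) * -x) = n * x by ring, Complex.exp_mul_I, Complex.exp_mul_I]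
      push_cast
      rw [Complex.cos_neg, Complex.sin_neg]
      ring
    rw [intervalIntegral.integral_congr e, intervalIntegral.integral_ofReal,
      intervalIntegral.integral_const_mul, Complex.real_smul, ← Complex.ofReal_mul]
    congr 1
    have : π - -π = 2 * π := by ring
    rw [this]
    field_simp
  have h := hasSum_sq_fourierCoeffOn hab hL2
  -- Pairing n with -n counts n = 0 twice, hence the extra term in the sum.
  have h2 := HasSum.nat_add_neg h
  convert h2 using 1
  · ext n
    have e : ∫ x in (0 : ℝ)..π, v x * cos (((-(n : ℤ) : ℤ) : ℝ) * x) =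
        ∫ x in (0 : ℝ)..π, v x * cos (n * x) := by
      congr 1; ext x; push_cast; rw [neg_mul, cos_neg]
    rw [hcoef, hcoef, e]
    simp only [Complex.norm_real, Real.norm_eq_abs, sq_abs]
    push_cast
    ring
  · rw [hcoef, Complex.norm_real, Real.norm_eq_abs, sq_abs]
    congr 1
    · have e1 : ∫ x in (-π)..π, ‖f x‖ ^ 2 = 2 * ∫ x in (0 : ℝ)..π, v x ^ 2 := by
        have hg : Continuous fun x => ‖f x‖ ^ 2 := by fun_prop
        rw [← intervalIntegral.integral_add_adjacent_intervals (b := 0)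
          (hg.intervalIntegrable _ _) (hg.intervalIntegrable _ _)]
        have e2 : ∫ x in (0 : ℝ)..π, ‖f x‖ ^ 2 = ∫ x in (0 : ℝ)..π, v x ^ 2 := by
          refine intervalIntegral.integral_congr fun x hx => ?_
          rw [uIcc_zero_pi] at hx
          simp [hf, abs_of_nonneg hx.1]
        have e3 : ∫ x in (-π)..0, ‖f x‖ ^ 2 = ∫ x in (0 : ℝ)..π, ‖f x‖ ^ 2 := by
          have := intervalIntegral.integral_comp_neg (a := 0) (b := π) fun x => ‖f x‖ ^ 2
          rw [neg_zero] at this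
          rw [← this]
          simp [hf]
        rw [e3, e2]; ring
      rw [e1, smul_eq_mul]
      have : π - -π = 2 * π := by ring
      rw [this]
      field_simp
    · rw [mul_pow]
      simp

/-- An orthogonal system quadratically close to the cosine system is complete. -/
theorem eq_zero_of_orthogonal {φ : ℕ → ℝ → ℝ} (hφc : ∀ n, Continuous (φ n))
    (hpos : ∀ n, 0 < ∫ x in (0 : ℝ)..π, φ n x ^ 2)
    (horth : ∀ m n, m ≠ n → ∫ x in (0 : ℝ)..π, φ m x * φ n x = 0) {C : ℝ} {N₀ : ℕ}
    (hclose : ∀ n ≥ N₀, ∀ x ∈ Icc 0 π, |φ n x - cos (n * x)| ≤ C / n)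
    {f : ℝ → ℝ} (hf : Continuous f) (hfo : ∀ n, ∫ x in (0 : ℝ)..π, f x * φ n x = 0)
    {x : ℝ} (hx : x ∈ Icc 0 π) : f x = 0 := by
  refine eq_zero_of_integral_sq_eq_zero hf ?_ hx
  by_contra hf0
  have hsum : Summable fun n : ℕ => 2 * C ^ 2 * (1 / (n : ℝ) ^ 2) :=
    (Real.summable_one_div_nat_pow.2 one_lt_two).mul_left _
  -- `N` makes the tail of the squared distances to the cosines less than 1.
  obtain ⟨N, hN1, hN⟩ := (((_root_.tendsto_sum_nat_add fun n : ℕ =>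
    2 * C ^ 2 * (1 / (n : ℝ) ^ 2)).eventually (gt_mem_nhds one_pos)).and
      (eventually_ge_atTop (max N₀ 1))).exists
  set g : Fin (N + 1) → ℝ → ℝ := fun i => if i.1 < N then φ i.1 else f with hg
  have hgc : ∀ i, Continuous (g i) := fun i => by
    simp only [hg]; split_ifs
    exacts [hφc _, hf]
  have hgg : ∀ i j, i ≠ j → ∫ x in (0 : ℝ)..π, g i x * g j x = 0 := by
    intro i j hij
    have hij' : i.1 ≠ j.1 := fun h => hij (Fin.ext h)
    simp only [hg]
    split_ifs with h1 h2 h2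
    · exact horth _ _ hij'
    · simp_rw [mul_comm (φ i.1 _)]; exact hfo _
    · exact hfo _
    · omega
  have hgpos : ∀ i, ∫ x in (0 : ℝ)..π, g i x * g i x ≠ 0 := by
    intro i
    simp only [hg, ← sq]
    split_ifs
    exacts [(hpos _).ne', hf0]
  -- The N + 1 functions φ₀, …, φ_{N-1}, f face only N conditions, orthogonality to the first N
  -- cosines, so some nontrivial combination `v` meets them all. It is also orthogonal to every φ_n
  -- with n ≥ N.
  let M : Matrix (Fin N) (Fin (N + 1)) ℝ := fun k i => ∫ x in (0 : ℝ)..π, g i x * cos (k.1 * x)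
  obtain ⟨t, ht, ht0⟩ := (Submodule.ne_bot_iff _).1
    (LinearMap.ker_ne_bot_of_finrank_lt (f := M.mulVecLin) (by simp))
  set v : ℝ → ℝ := fun x => ∑ i, t i * g i x with hv
  have hvc : Continuous v := by simp only [hv]; fun_prop
  have hvint : ∀ w : ℝ → ℝ, Continuous w → ∫ x in (0 : ℝ)..π, v x * w x =
      ∑ i, t i * ∫ x in (0 : ℝ)..π, g i x * w x := by
    intro w hw
    simp only [hv, Finset.sum_mul, mul_assoc]
    rw [intervalIntegral.integral_finsetSum fun i _ =>
      (by fun_prop : Continuous _).intervalIntegrable _ _]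
    simp_rw [intervalIntegral.integral_const_mul]
  have hvcos : ∀ k < N, ∫ x in (0 : ℝ)..π, v x * cos (k * x) = 0 := by
    intro k hk
    rw [hvint _ (by fun_prop)]
    have := congrFun (LinearMap.mem_ker.1 ht) ⟨k, hk⟩
    simp only [Matrix.mulVecLin_apply, Matrix.mulVec, dotProduct, Pi.zero_apply] at this
    refine Eq.trans ?_ this
    exact Finset.sum_congr rfl fun i _ => mul_comm _ _
  have hvφ : ∀ n ≥ N, ∫ x in (0 : ℝ)..π, v x * φ n x = 0 := by
    intro n hn
    rw [hvint _ (hφc n)]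
    refine Finset.sum_eq_zero fun i _ => ?_
    simp only [hg]
    split_ifs with h1
    · rw [horth _ _ (by omega), mul_zero]
    · rw [hfo, mul_zero]
  set V := ∫ x in (0 : ℝ)..π, v x ^ 2 with hVdef
  have hV0 : 0 ≤ V := intervalIntegral.integral_nonneg pi_pos.le fun _ _ => sq_nonneg _
  have hV : V = 0 := by
    by_contra hVne
    have hVpos : 0 < V := lt_of_le_of_ne hV0 (Ne.symm hVne)
    have hP := hasSum_sq_cos_coeff hvc
    have hN1' : 1 ≤ N := (le_max_right _ _).trans hN
    rw [hvcos 0 (by omega)] at hP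
    have hP2 := (_root_.hasSum_nat_add_iff' N).2 hP
    rw [Finset.sum_eq_zero (fun k hk => by rw [hvcos k (Finset.mem_range.1 hk)]; ring)] at hP2
    have hterm : ∀ n : ℕ, 2 / π ^ 2 * (∫ x in (0 : ℝ)..π, v x * cos ((n + N : ℕ) * x)) ^ 2 ≤
        V / π * (2 * C ^ 2 * (1 / ((n + N : ℕ) : ℝ) ^ 2)) := by
      intro n
      set m := n + N with hm
      have hmpos : (0 : ℝ) < m := by
        have : 0 < m := by omega
        exact_mod_cast this
      have e : ∫ x in (0 : ℝ)..π, v x * cos (m * x) =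
          -∫ x in (0 : ℝ)..π, v x * (φ m x - cos (m * x)) := by
        simp only [mul_sub]
        rw [intervalIntegral.integral_sub ((hvc.fun_mul (hφc m)).intervalIntegrable _ _)
          ((by fun_prop : Continuous fun x => v x * cos (m * x)).intervalIntegrable _ _), hvφ m (by omega)]
        ring
      have hb := abs_integral_le_mul (q := v) (f := fun x => v x * (φ m x - cos (m * x)))
        (M := C / m) (hvc.intervalIntegrable _ _) (fun t ht => by
          rw [abs_mul]
          exact mul_le_mul_of_nonneg_left
            (hclose m (((le_max_left _ _).trans hN).trans (by omega)) t ht) (abs_nonneg _)) pi_mem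
      have hsq := sq_integral_abs_le hvc
      rw [e, neg_sq]
      calc _ = 2 / π ^ 2 * |∫ x in (0 : ℝ)..π, v x * (φ m x - cos (m * x))| ^ 2 := by
            rw [sq_abs (∫ x in (0 : ℝ)..π, v x * (φ m x - cos (m * x)))]
        _ ≤ 2 / π ^ 2 * ((∫ x in (0 : ℝ)..π, |v x|) * (C / m)) ^ 2 :=
            mul_le_mul_of_nonneg_left (pow_le_pow_left₀ (abs_nonneg _) hb 2) (by positivity)
        _ = 2 / π ^ 2 * (C / m) ^ 2 * (∫ x in (0 : ℝ)..π, |v x|) ^ 2 := by ring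
        _ ≤ 2 / π ^ 2 * (C / m) ^ 2 * (π * V) := by gcongr
        _ = _ := by field_simp
    -- Parseval leaves only the cosine coefficients with n ≥ N, where cos(nx) may be replaced by
    -- cos(nx) - φ_n; their total is strictly less than V/π, yet must equal it.
    have hle := hasSum_le hterm hP2
      (((_root_.summable_nat_add_iff N).2 hsum).hasSum.mul_left (V / π))
    have hlt : V / π * (∑' n : ℕ, 2 * C ^ 2 * (1 / ((n + N : ℕ) : ℝ) ^ 2)) < V / π * 1 := by
      have : 0 < V / π := by positivity
      gcongr
    have e : 1 / π * V + 1 / π ^ 2 * (0 : ℝ) ^ 2 - 0 = V / π * 1 := by ring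
    rw [e] at hle
    linarith
  have hvz : ∀ x ∈ Icc 0 π, v x = 0 := fun x hx => eq_zero_of_integral_sq_eq_zero hvc hV hx
  -- The functions `g i` are orthogonal with nonzero norms, so v = 0 forces every coefficient to
  -- vanish, against the choice of `t`.
  apply ht0
  ext j
  have h1 := hvint (g j) (hgc j)
  rw [Finset.sum_eq_single j (fun i _ hij => by rw [hgg i j hij, mul_zero]) (by simp),
    intervalIntegral.integral_congr (g := fun _ => (0 : ℝ)) (fun x hx => by
      rw [uIcc_zero_pi] at hx; simp [hvz x hx])] at h1
  simp only [intervalIntegral.integral_zero] at h1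
  exact (mul_eq_zero.1 h1.symm).resolve_right (hgpos j)

/-- Pointwise expansion of a continuous function in a complete orthogonal system. -/
theorem hasSum_expansion {φ : ℕ → ℝ → ℝ} (hφc : ∀ n, Continuous (φ n))
    (hpos : ∀ n, 0 < ∫ x in (0 : ℝ)..π, φ n x ^ 2)
    (horth : ∀ m n, m ≠ n → ∫ x in (0 : ℝ)..π, φ m x * φ n x = 0) {C : ℝ} {N₀ : ℕ}
    (hclose : ∀ n ≥ N₀, ∀ x ∈ Icc 0 π, |φ n x - cos (n * x)| ≤ C / n)
    {M : ℝ} (hM : ∀ n, ∀ x ∈ Icc 0 π, |φ n x| ≤ M)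
    {g : ℝ → ℝ} (hg : Continuous g) {c : ℕ → ℝ} (hc : Summable fun n => |c n|)
    (hgc : ∀ n, ∫ x in (0 : ℝ)..π, g x * φ n x = c n * ∫ x in (0 : ℝ)..π, φ n x ^ 2)
    {x : ℝ} (hx : x ∈ Icc 0 π) : HasSum (fun n => c n * φ n x) (g x) := by
  have hM0 : 0 ≤ M := (abs_nonneg _).trans (hM 0 0 zero_mem)
  -- Clamping the argument to [0, π] extends the bound `M` to the whole line, so the series
  -- converges uniformly to a continuous function.
  set p : ℝ → ℝ := fun x => max 0 (min x π) with hp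
  have hpc : Continuous p := by fun_prop
  have hpm : ∀ x, p x ∈ Icc 0 π := fun x =>
    ⟨le_max_left _ _, max_le pi_pos.le (min_le_right _ _)⟩
  have hpx : ∀ x ∈ Icc 0 π, p x = x := fun x hx => by
    simp only [hp]; rw [min_eq_left hx.2, max_eq_right hx.1]
  have hbd : ∀ n, ∀ x, ‖c n * φ n (p x)‖ ≤ |c n| * M := fun n x => by
    rw [norm_mul]
    exact mul_le_mul_of_nonneg_left (hM n _ (hpm x)) (abs_nonneg _)
  have hcM : Summable fun n => |c n| * M := hc.mul_right M
  set S : ℝ → ℝ := fun x => ∑' n, c n * φ n (p x) with hS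
  have hSc : Continuous S := continuous_tsum (fun n => by
    have := hφc n
    fun_prop) hcM hbd
  have hSs : ∀ x, HasSum (fun n => c n * φ n (p x)) (S x) := fun x =>
    (Summable.of_norm_bounded hcM fun n => hbd n x).hasSum
  have hSφ : ∀ m, ∫ x in (0 : ℝ)..π, S x * φ m x = c m * ∫ x in (0 : ℝ)..π, φ m x ^ 2 := by
    intro m
    have h1 : HasSum (fun n => ∫ x in (0 : ℝ)..π, c n * φ n (p x) * φ m x)
        (∫ x in (0 : ℝ)..π, S x * φ m x) := by
      refine intervalIntegral.hasSum_integral_of_dominated_convergence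
        (fun n _ => |c n| * M * M) (fun n => ?_) (fun n => ?_) ?_ ?_ ?_
      · have := hφc n
        have := hφc m
        exact (by fun_prop : Continuous _).aestronglyMeasurable
      · refine ae_of_all _ fun t ht => ?_
        rw [uIoc_of_le pi_pos.le] at ht
        rw [norm_mul]
        exact mul_le_mul (hbd n t) (hM m t (Ioc_subset_Icc_self ht)) (norm_nonneg _)
          (mul_nonneg (abs_nonneg _) hM0)
      · exact ae_of_all _ fun t _ => hcM.mul_right M
      · exact intervalIntegrable_const
      · exact ae_of_all _ fun t _ => (hSs t).mul_right _
    have h2 : ∀ n, ∫ x in (0 : ℝ)..π, c n * φ n (p x) * φ m x =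
        c n * ∫ x in (0 : ℝ)..π, φ n x * φ m x := by
      intro n
      rw [← intervalIntegral.integral_const_mul]
      refine intervalIntegral.integral_congr fun x hx => ?_
      rw [uIcc_zero_pi] at hx
      rw [hpx x hx]; ring
    simp only [h2] at h1
    have h3 := hasSum_single (f := fun n => c n * ∫ x in (0 : ℝ)..π, φ n x * φ m x) m
      fun n hn => by rw [horth n m hn, mul_zero]
    rw [h1.unique h3]
    simp only [sq]
  -- `g` and the sum of the series have the same coefficients; completeness then makes them equal at
  -- every point.
  have hfo : ∀ n, ∫ x in (0 : ℝ)..π, (g x - S x) * φ n x = 0 := fun n => by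
    simp only [sub_mul]
    rw [intervalIntegral.integral_sub ((hg.fun_mul (hφc n)).intervalIntegrable _ _)
      ((hSc.fun_mul (hφc n)).intervalIntegrable _ _), hgc, hSφ, sub_self]
  have h0 := eq_zero_of_orthogonal hφc hpos horth hclose (hg.sub hSc) hfo hx
  have h1 := hSs x
  rw [hpx x hx] at h1
  rwa [sub_eq_zero.1 h0]

/-! ### Reflection, Green's identity and the Green function at the left end -/

theorem pi_sub_mem {x : ℝ} (hx : x ∈ Icc 0 π) : π - x ∈ Icc 0 π :=
  ⟨by linarith [hx.2], by linarith [hx.1]⟩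

theorem intervalIntegrable_reflect {f : ℝ → ℝ} (hf : IntervalIntegrable f volume 0 π) :
    IntervalIntegrable (fun x => f (π - x)) volume 0 π := by
  simpa using (hf.comp_sub_left π).symm

theorem ACD.reflect {f f' : ℝ → ℝ} (hf : ACD f f') :
    ACD (fun x => f (π - x)) fun x => -f' (π - x) := by
  have hi := intervalIntegrable_reflect hf.intervalIntegrable
  refine (((ACD.const (f π)).add (ACD.of_integral hi.neg)).congr_fun fun x hx => ?_).congr_deriv
    fun x _ => by simp
  simp only [Pi.neg_apply]
  rw [intervalIntegral.integral_neg, intervalIntegral.integral_comp_sub_left f', sub_zero,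
    ← intervalIntegral.integral_interval_sub_left hf.intervalIntegrable
      (intervalIntegrable_sub hf.intervalIntegrable (pi_sub_mem hx)),
    hf.integral_eq_sub pi_mem, hf.integral_eq_sub (pi_sub_mem hx)]
  ring

theorem RealSol.reflect {q y z : ℝ → ℝ} {l : ℝ} (hy : RealSol q l y z) :
    RealSol (fun x => q (π - x)) l (fun x => y (π - x)) fun x => -z (π - x) :=
  ⟨hy.fst.reflect, hy.snd.reflect.neg.congr_deriv fun x _ => by ring⟩

/-- Green's identity for two solutions. -/
theorem RealSol.integral_mul {q y z y' z' : ℝ → ℝ} {l l' : ℝ} (hy : RealSol q l y z)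
    (hy' : RealSol q l' y' z') :
    (l - l') * ∫ x in (0 : ℝ)..π, y x * y' x =
      (y π * z' π - z π * y' π) - (y 0 * z' 0 - z 0 * y' 0) := by
  have h : ACD (fun x => y x * z' x - z x * y' x) fun x => (l - l') * (y x * y' x) :=
    ((hy.fst.mul hy'.snd).sub (hy.snd.mul hy'.fst)).congr_deriv fun x _ => by ring
  rw [← intervalIntegral.integral_const_mul]
  exact h.integral_eq_sub pi_mem

theorem exists_bound_of_forall_ge {f : ℕ → ℝ} {N : ℕ} {C : ℝ} (h : ∀ n ≥ N, |f n| ≤ C) :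
    ∃ K, 0 ≤ K ∧ ∀ n, |f n| ≤ K := by
  refine ⟨|C| + ∑ i ∈ Finset.range N, |f i|, by positivity, fun n => ?_⟩
  rcases lt_or_ge n N with hn | hn
  · have := Finset.single_le_sum (f := fun i => |f i|) (fun i _ => abs_nonneg _)
      (Finset.mem_range.2 hn)
    have := abs_nonneg C
    linarith
  · have := h n hn
    have := le_abs_self C
    have : 0 ≤ ∑ i ∈ Finset.range N, |f i| := by positivity
    linarith

/-- A sequence of eigenvalues whose eigenfunctions are close to the cosine system. -/
structure EigenSystem (q : ℝ → ℝ) (h H : ℝ) (y z : ℝ → ℝ → ℝ) (μ : ℕ → ℝ) : Prop where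
  family : SolFamily q h y z
  strictMono : StrictMono μ
  boundary : ∀ n, z (μ n) π + H * y (μ n) π = 0
  bounded : ∃ C, 0 ≤ C ∧ ∀ n : ℕ, |μ n - (n : ℝ) ^ 2| ≤ C
  close : ∃ C, 0 ≤ C ∧ ∃ N : ℕ, 1 ≤ N ∧ ∀ n ≥ N, ∀ x ∈ Icc 0 π, |y (μ n) x - cos (n * x)| ≤ C / n
  one_le : ∀ᶠ n in atTop, 1 ≤ ∫ x in (0 : ℝ)..π, y (μ n) x ^ 2

namespace EigenSystem

variable {q : ℝ → ℝ} {h H : ℝ} {y z : ℝ → ℝ → ℝ} {μ : ℕ → ℝ}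

theorem integral_sq_pos (hs : EigenSystem q h H y z μ) (n : ℕ) :
    0 < ∫ x in (0 : ℝ)..π, y (μ n) x ^ 2 :=
  intervalIntegral.integral_pos pi_pos ((hs.family.fst_cont _).pow 2).continuousOn
    (fun _ _ => sq_nonneg _) ⟨0, zero_mem, by rw [hs.family.fst_zero]; norm_num⟩

theorem orthogonal (hs : EigenSystem q h H y z μ) (m n : ℕ) (hmn : m ≠ n) :
    ∫ x in (0 : ℝ)..π, y (μ m) x * y (μ n) x = 0 := by
  have h1 := (hs.family.sol (μ m)).integral_mul (hs.family.sol (μ n))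
  have e : (y (μ m) π * z (μ n) π - z (μ m) π * y (μ n) π) -
      (y (μ m) 0 * z (μ n) 0 - z (μ m) 0 * y (μ n) 0) = 0 := by
    rw [hs.family.fst_zero, hs.family.fst_zero, hs.family.snd_zero, hs.family.snd_zero]
    linear_combination (y (μ m) π) * hs.boundary n - (y (μ n) π) * hs.boundary m
  rw [e] at h1
  exact (mul_eq_zero.1 h1).resolve_left
    (sub_ne_zero.2 fun h => hmn (hs.strictMono.injective h))

theorem exists_bound (hs : EigenSystem q h H y z μ) :
    ∃ M, ∀ n, ∀ x ∈ Icc 0 π, |y (μ n) x| ≤ M := by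
  obtain ⟨C, hC, N, hN, hclose⟩ := hs.close
  choose x₀ hx₀ hmax using fun n => exists_max_abs (hs.family.fst_cont (μ n)).continuousOn
  obtain ⟨K, -, hK⟩ := exists_bound_of_forall_ge (f := fun n => y (μ n) (x₀ n)) (N := N)
    (C := C + 1) fun n hn => by
      have h1 := hclose n hn _ (hx₀ n)
      have h2 := abs_sub_abs_le_abs_sub (y (μ n) (x₀ n)) (cos (n * x₀ n))
      have h3 := abs_cos_le_one (n * x₀ n)
      have h4 : (1 : ℝ) ≤ n := by exact_mod_cast hN.trans hn
      have h5 : C / n ≤ C := div_le_self hC h4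
      linarith
  exact ⟨K, fun n x hx => (hmax n x hx).trans (hK n)⟩

theorem summable_coeff (hs : EigenSystem q h H y z μ) (k : ℝ) :
    Summable fun n => |1 / ((∫ x in (0 : ℝ)..π, y (μ n) x ^ 2) * (μ n + k ^ 2))| := by
  obtain ⟨C, hC, hb⟩ := hs.bounded
  have hsum : Summable fun n : ℕ => 2 * (1 / (n : ℝ) ^ 2) :=
    (Real.summable_one_div_nat_pow.2 one_lt_two).mul_left _
  obtain ⟨N, hN⟩ := exists_nat_ge (2 * C + 1)
  refine Summable.of_norm_bounded_eventually_nat hsum ?_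
  filter_upwards [hs.one_le, eventually_ge_atTop N] with n h1 hn
  have hn' : 2 * C + 1 ≤ (n : ℝ) := hN.trans (by exact_mod_cast hn)
  have h2 := (abs_le.1 (hb n)).1
  have h3 : (n : ℝ) ^ 2 / 2 ≤ μ n + k ^ 2 := by nlinarith [sq_nonneg k]
  have h4 : 0 < (n : ℝ) ^ 2 / 2 := by
    have : (0 : ℝ) < n := by linarith
    positivity
  have h5 : (n : ℝ) ^ 2 / 2 ≤ (∫ x in (0 : ℝ)..π, y (μ n) x ^ 2) * (μ n + k ^ 2) := by nlinarith
  rw [Real.norm_eq_abs, abs_abs, abs_of_nonneg (one_div_nonneg.2 (h4.le.trans h5))]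
  calc _ ≤ 1 / ((n : ℝ) ^ 2 / 2) := one_div_le_one_div_of_le h4 h5
    _ = _ := by field_simp

/-- The expansion of the Green function at the left endpoint. -/
theorem hasSum_green (hq : IntervalIntegrable q volume 0 π) (hs : EigenSystem q h H y z μ) :
    ∃ ε : ℝ → ℝ, Tendsto ε atTop (𝓝 0) ∧ ∀ᶠ k : ℝ in atTop,
      HasSum (fun n => 1 / ((∫ x in (0 : ℝ)..π, y (μ n) x ^ 2) * (μ n + k ^ 2)))
        (1 / (h + k + ε k)) := by
  have hq' := intervalIntegrable_reflect hq
  obtain ⟨Y, Z, hYZ⟩ := SolFamily.exists hq' H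
  have hε := hYZ.tendsto_log_deriv hq'
  refine ⟨_, hε, ?_⟩
  obtain ⟨C, hC, N, hN, hclose⟩ := hs.close
  obtain ⟨M, hM⟩ := hs.exists_bound
  have h1 := hε.eventually (lt_mem_nhds (by norm_num : (-1 : ℝ) < 0))
  filter_upwards [hYZ.eventually_pos hq', h1, eventually_gt_atTop (1 + |h| + |μ 0|)]
    with k hpos hk hk2
  -- `Y` solves the reflected problem with slope H, so `u` satisfies the boundary condition at π.
  set u := fun x => Y (-k ^ 2) (π - x) with hu
  have hsol : RealSol q (-k ^ 2) u fun x => -Z (-k ^ 2) (π - x) := by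
    have := (hYZ.sol (-k ^ 2)).reflect
    simpa only [sub_sub_cancel] using this
  have huc : Continuous u := by
    have := hYZ.fst_cont (-k ^ 2)
    simp only [hu]; fun_prop
  have hYpos := hpos π pi_mem
  -- D = h u(0) - u'(0) is the Wronskian normalization, and u/D is the Green function with one
  -- argument at 0.
  set D := h * Y (-k ^ 2) π + Z (-k ^ 2) π with hD
  have hden : 0 < h + k + (Z (-k ^ 2) π / Y (-k ^ 2) π - k) := by
    have := neg_abs_le h
    have := abs_nonneg (μ 0)
    linarith
  have hDe : D = Y (-k ^ 2) π * (h + k + (Z (-k ^ 2) π / Y (-k ^ 2) π - k)) := by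
    simp only [hD]; field_simp; ring
  have hD0 : D ≠ 0 := by rw [hDe]; positivity
  have hμk : ∀ n, 0 < μ n + k ^ 2 := fun n => by
    have h2 := hs.strictMono.monotone (Nat.zero_le n)
    have h3 := neg_abs_le (μ 0)
    have h4 := abs_nonneg h
    nlinarith [abs_nonneg (μ 0)]
  have hint : ∀ n, ∫ x in (0 : ℝ)..π, u x * y (μ n) x = D / (μ n + k ^ 2) := by
    intro n
    have h2 := hsol.integral_mul (hs.family.sol (μ n))
    have e : (u π * z (μ n) π - (-Z (-k ^ 2) (π - π)) * y (μ n) π) -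
        (u 0 * z (μ n) 0 - (-Z (-k ^ 2) (π - 0)) * y (μ n) 0) = -D := by
      simp only [hu, sub_self, sub_zero, hYZ.fst_zero, hYZ.snd_zero, hs.family.fst_zero,
        hs.family.snd_zero]
      linear_combination hs.boundary n
    rw [e] at h2
    rw [eq_div_iff (hμk n).ne']
    linear_combination -h2
  -- The coefficients of u/D come from Green's identity, where the condition at π kills one boundary
  -- term and the other is D. Evaluation at 0 uses y_n(0) = 1.
  have hfin := hasSum_expansion (φ := fun n => y (μ n)) (fun n => hs.family.fst_cont _)
    hs.integral_sq_pos hs.orthogonal hclose hM (g := fun x => D⁻¹ * u x) (by fun_prop)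
    (hs.summable_coeff k) (fun n => by
      simp only [mul_assoc]
      rw [intervalIntegral.integral_const_mul, hint]
      have := (hμk n).ne'
      have := (hs.integral_sq_pos n).ne'
      field_simp) zero_mem
  simp only [hs.family.fst_zero, mul_one] at hfin
  convert hfin using 1
  simp only [hu, sub_zero]
  rw [hDe]
  field_simp

end EigenSystem

/-! ### Comparison with the free problem and the limit k → ∞ -/

/-- The product of the sine coefficient and 1/n is at most the sum of their squares. -/
theorem summable_norming_error {q : ℝ → ℝ} (hq : MemLp q 2 (volume.restrict (Icc 0 π))) (C : ℝ) :
    Summable fun n : ℕ => |sineCoeff q n| / n + C / (n : ℝ) ^ 2 := by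
  have h1 : Summable fun n : ℕ => 1 / (n : ℝ) ^ 2 := Real.summable_one_div_nat_pow.2 one_lt_two
  have h2 := (summable_sineCoeff_sq hq).add h1
  refine Summable.add (Summable.of_nonneg_of_le (fun n => by positivity) (fun n => ?_) h2)
    ((h1.mul_left C).congr fun n => by ring)
  have h3 : 0 ≤ 1 / (n : ℝ) := by positivity
  have h4 : |sineCoeff q n| / n = |sineCoeff q n| * (1 / n) := by ring
  have h5 : 1 / (n : ℝ) ^ 2 = (1 / n) ^ 2 := by ring
  rw [h4, h5, ← sq_abs (sineCoeff q n)]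
  nlinarith [sq_nonneg (|sineCoeff q n| - 1 / n), abs_nonneg (sineCoeff q n)]

/-- The reciprocal norming constants of the unperturbed problem. -/
noncomputable def freeWeight (n : ℕ) : ℝ := if n = 0 then 1 / π else 2 / π

/-- The eigenvalue problem as an `EigenSystem`, with summable norming constants. -/
theorem SolFamily.eigenSystem {q : ℝ → ℝ} {h H : ℝ} {y z : ℝ → ℝ → ℝ} {μ : ℕ → ℝ}
    (hq : MemLp q 2 (volume.restrict (Icc 0 π))) (hqi : IntervalIntegrable q volume 0 π)
    (hy : SolFamily q h y z) (hμm : StrictMono μ)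
    (hμ : ∀ n, z (μ n) π + H * y (μ n) π = 0) {N₀ : ℕ}
    (hloc : ∀ n ≥ N₀, ((n : ℝ) - 1 / 2) ^ 2 < μ n ∧ μ n < ((n : ℝ) + 1 / 2) ^ 2) :
    EigenSystem q h H y z μ ∧
      Summable fun n => |1 / (∫ x in (0 : ℝ)..π, y (μ n) x ^ 2) - freeWeight n| := by
  obtain ⟨C, hC, N, hN, hasymp⟩ := hy.eigen_asymptotics hqi hμ hloc
  have hsum := summable_norming_error hq C
  have hone : ∀ᶠ n in atTop, 1 ≤ ∫ x in (0 : ℝ)..π, y (μ n) x ^ 2 := by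
    filter_upwards [eventually_ge_atTop N,
      hsum.tendsto_atTop_zero.eventually (gt_mem_nhds (by norm_num : (0 : ℝ) < 1 / 2))]
      with n hn h1
    have h2 := (abs_le.1 (hasymp n hn).2.2).1
    linarith [pi_gt_three]
  refine ⟨⟨hy, hμm, hμ, ?_, ⟨C, hC, N, hN, fun n hn => (hasymp n hn).2.1⟩, hone⟩, ?_⟩
  · obtain ⟨K, hK, hK'⟩ := exists_bound_of_forall_ge (f := fun n => μ n - (n : ℝ) ^ 2)
      fun n hn => (hasymp n hn).1
    exact ⟨K, hK, hK'⟩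
  · refine Summable.of_norm_bounded_eventually_nat hsum ?_
    filter_upwards [hone, eventually_ge_atTop N] with n h1 hn
    have h2 := (hasymp n hn).2.2
    set a := ∫ x in (0 : ℝ)..π, y (μ n) x ^ 2 with ha
    have ha0 : 0 < a := by linarith
    rw [Real.norm_eq_abs, abs_abs, freeWeight, if_neg (by omega)]
    refine le_trans ?_ h2
    -- Passing to reciprocals costs nothing, as a ≥ 1 and π/2 ≥ 1.
    have e : 1 / a - 2 / π = -(a - π / 2) / (a * (π / 2)) := by field_simp; ring
    rw [e, abs_div, abs_neg, abs_of_pos (by positivity : 0 < a * (π / 2))]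
    refine div_le_self (abs_nonneg _) ?_
    nlinarith [pi_gt_three]

/-- The comparison problem q = 0, h = H = 0, with eigenfunctions cos(nx). For n ≠ 0 the norm is read
off from `RealSol.integral_sq`. -/
theorem exists_free_eigenSystem : ∃ y z : ℝ → ℝ → ℝ,
    EigenSystem (fun _ => 0) 0 0 y z (fun n => (n : ℝ) ^ 2) ∧
      ∀ n : ℕ, 1 / (∫ x in (0 : ℝ)..π, y ((n : ℝ) ^ 2) x ^ 2) = freeWeight n := by
  have hq : IntervalIntegrable (fun _ : ℝ => (0 : ℝ)) volume 0 π := intervalIntegrable_const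
  obtain ⟨y, z, hyz⟩ := SolFamily.exists hq 0
  have hcos : ∀ n : ℕ, ∀ x ∈ Icc 0 π, y ((n : ℝ) ^ 2) x = cos (n * x) ∧
      z ((n : ℝ) ^ 2) x = -(n * sin (n * x)) := by
    intro n x hx
    have hlin : ACD (fun x => (n : ℝ) * x) fun _ => (n : ℝ) :=
      (ACD.id.const_mul (n : ℝ)).congr_deriv fun x _ => by ring
    have hsol : RealSol (fun _ => 0) ((n : ℝ) ^ 2) (fun x => cos (n * x))
        fun x => -(n * sin (n * x)) :=
      ⟨hlin.cos.congr_deriv fun x _ => by ring,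
        (hlin.sin.const_mul (n : ℝ)).neg.congr_deriv fun x _ => by ring⟩
    exact (hyz.sol _).unique hq hsol (by rw [hyz.fst_zero]; simp) (by rw [hyz.snd_zero]; simp) hx
  have hz : ∀ n : ℕ, z ((n : ℝ) ^ 2) π = 0 := fun n => by
    rw [(hcos n π pi_mem).2, sin_nat_mul_pi]; simp
  have hint : ∀ n : ℕ, n ≠ 0 → ∫ x in (0 : ℝ)..π, y ((n : ℝ) ^ 2) x ^ 2 = π / 2 := by
    intro n hn
    have h1 := (hyz.sol ((n : ℝ) ^ 2)).integral_sq hq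
    rw [hz, hyz.fst_zero, hyz.snd_zero] at h1
    simp only [zero_mul, mul_zero, intervalIntegral.integral_zero] at h1
    have hn' : (n : ℝ) ^ 2 ≠ 0 := by positivity
    refine mul_left_cancel₀ hn' ?_
    linear_combination h1 / 2
  have hint0 : ∫ x in (0 : ℝ)..π, y (((0 : ℕ) : ℝ) ^ 2) x ^ 2 = π := by
    rw [intervalIntegral.integral_congr (g := fun _ => (1 : ℝ)) fun x hx => by
      rw [uIcc_zero_pi] at hx
      simp only [(hcos 0 x hx).1]
      simp]
    simp
  refine ⟨y, z, ⟨hyz, fun m n hmn => ?_, fun n => by rw [hz]; simp, ⟨0, le_rfl, fun n => by simp⟩,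
    ⟨0, le_rfl, 1, le_rfl, fun n _ x hx => by simp [(hcos n x hx).1]⟩, ?_⟩, fun n => ?_⟩
  · have : (m : ℝ) < n := by exact_mod_cast hmn
    exact pow_lt_pow_left₀ this (by positivity) two_ne_zero
  · filter_upwards [eventually_ge_atTop 1] with n hn
    rw [hint n (by omega)]
    linarith [pi_gt_three]
  · rw [freeWeight]
    split_ifs with h0
    · rw [h0, hint0]
    · rw [hint n h0]; field_simp

/-- After multiplication by k² the difference is (ε₀ - ε - h) over a factor tending to 1, so knowing
the logarithmic derivative up to o(1) is exactly enough. The `0` stands for the slope of the free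
problem. -/
theorem tendsto_green_difference {ε ε₀ : ℝ → ℝ} (h : ℝ) (hε : Tendsto ε atTop (𝓝 0))
    (hε₀ : Tendsto ε₀ atTop (𝓝 0)) :
    Tendsto (fun k : ℝ => k ^ 2 * (1 / (h + k + ε k) - 1 / (0 + k + ε₀ k))) atTop (𝓝 (-h)) := by
  have hinv : Tendsto (fun k : ℝ => k⁻¹) atTop (𝓝 0) := tendsto_inv_atTop_zero
  have h1 : Tendsto (fun k : ℝ => (ε₀ k - ε k - h) /
      ((h * k⁻¹ + 1 + ε k * k⁻¹) * (1 + ε₀ k * k⁻¹))) atTop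
      (𝓝 ((0 - 0 - h) / ((h * 0 + 1 + 0 * 0) * (1 + 0 * 0)))) := by
    refine Tendsto.div ((hε₀.sub hε).sub tendsto_const_nhds) ?_ (by norm_num)
    exact (((hinv.const_mul h).add tendsto_const_nhds).add (hε.mul hinv)).mul
      (tendsto_const_nhds.add (hε₀.mul hinv))
  have e : (0 - 0 - h) / ((h * 0 + 1 + 0 * 0) * (1 + 0 * 0)) = -h := by ring
  rw [e] at h1
  refine h1.congr' ?_
  filter_upwards [eventually_gt_atTop (2 + |h|), hε.eventually (lt_mem_nhds neg_one_lt_zero),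
    hε₀.eventually (lt_mem_nhds neg_one_lt_zero)] with k hk h2 h3
  have h4 := neg_abs_le h
  have h5 := abs_nonneg h
  have hk0 : k ≠ 0 := by linarith
  have h6 : h + k + ε k ≠ 0 := by linarith
  have h7 : 0 + k + ε₀ k ≠ 0 := by linarith
  have e1 : h * k⁻¹ + 1 + ε k * k⁻¹ = (h + k + ε k) / k := by field_simp
  have e2 : 1 + ε₀ k * k⁻¹ = (0 + k + ε₀ k) / k := by field_simp; ring
  rw [e1, e2]
  field_simp
  ring

theorem tendsto_regularized_term (d w m b : ℝ) :
    Tendsto (fun k : ℝ => d * (k ^ 2 / (m + k ^ 2)) +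
      w * (k ^ 2 / (m + k ^ 2)) * ((b - m) / (b + k ^ 2))) atTop (𝓝 d) := by
  have hk2 : Tendsto (fun k : ℝ => k ^ 2) atTop atTop := tendsto_pow_atTop two_ne_zero
  have h1 : Tendsto (fun k : ℝ => k ^ 2 / (m + k ^ 2)) atTop (𝓝 1) := by
    have h2 : Tendsto (fun k : ℝ => 1 - m / (m + k ^ 2)) atTop (𝓝 (1 - 0)) :=
      tendsto_const_nhds.sub (tendsto_const_nhds.div_atTop
        (tendsto_atTop_add_const_left _ _ hk2))
    rw [sub_zero] at h2
    refine h2.congr' ?_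
    filter_upwards [eventually_gt_atTop (1 + |m|)] with k hk
    have h3 := neg_abs_le m
    have h4 := abs_nonneg m
    have : 0 < m + k ^ 2 := by nlinarith
    field_simp
    ring
  have h3 : Tendsto (fun k : ℝ => (b - m) / (b + k ^ 2)) atTop (𝓝 0) :=
    tendsto_const_nhds.div_atTop (tendsto_atTop_add_const_left _ _ hk2)
  have h4 := (h1.const_mul (d)).add ((h1.const_mul (w)).mul h3)
  simpa using h4

/-- A majorant independent of k for dominated convergence; it rests on 2 (n² + k²) ≥ (n + 1)² for k
≥ 1. -/
theorem abs_regularized_term_le {d w m k C : ℝ} {n : ℕ} (hw : 0 ≤ w) (hw1 : w ≤ 1)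
    (hC : 0 ≤ C) (hb : |m - (n : ℝ) ^ 2| ≤ C) (hkn : k ^ 2 / 2 ≤ m + k ^ 2) (hk1 : 1 ≤ k) :
    |d * (k ^ 2 / (m + k ^ 2)) +
      w * (k ^ 2 / (m + k ^ 2)) * (((n : ℝ) ^ 2 - m) / ((n : ℝ) ^ 2 + k ^ 2))| ≤
      |d| * 2 + 4 * C * (1 / ((n : ℝ) + 1) ^ 2) := by
  have hpos : 0 < m + k ^ 2 := by nlinarith
  have h1 : |k ^ 2 / (m + k ^ 2)| ≤ 2 := by
    rw [abs_of_nonneg (by positivity), div_le_iff₀ hpos]; linarith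
  have h2 : |((n : ℝ) ^ 2 - m) / ((n : ℝ) ^ 2 + k ^ 2)| ≤ C * (2 / ((n : ℝ) + 1) ^ 2) := by
    have h3 : 0 < (n : ℝ) ^ 2 + k ^ 2 := by nlinarith [sq_nonneg (n : ℝ)]
    rw [abs_div, abs_of_pos h3, abs_sub_comm, div_eq_mul_one_div]
    refine mul_le_mul hb ?_ (by positivity) hC
    rw [div_le_div_iff₀ h3 (by positivity)]
    nlinarith [sq_nonneg ((n : ℝ) - 1)]
  refine (abs_add_le _ _).trans (add_le_add ?_ ?_)
  · rw [abs_mul]; gcongr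
  · rw [abs_mul, abs_mul, abs_of_nonneg hw]
    calc _ ≤ 1 * 2 * (C * (2 / ((n : ℝ) + 1) ^ 2)) := by
          gcongr
      _ = _ := by ring

theorem freeWeight_nonneg (n : ℕ) : 0 ≤ freeWeight n := by
  rw [freeWeight]; split_ifs <;> positivity

theorem freeWeight_le_one (n : ℕ) : freeWeight n ≤ 1 := by
  have := pi_gt_three
  rw [freeWeight]
  split_ifs <;> rw [div_le_one pi_pos] <;> linarith

theorem tendsto_tsum_regularized {d w μ : ℕ → ℝ} {C : ℝ} (hd : Summable fun n => |d n|)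
    (hw : ∀ n, 0 ≤ w n) (hw1 : ∀ n, w n ≤ 1) (hC : 0 ≤ C)
    (hb : ∀ n : ℕ, |μ n - (n : ℝ) ^ 2| ≤ C)
    (hμk : ∀ᶠ k : ℝ in atTop, ∀ n, k ^ 2 / 2 ≤ μ n + k ^ 2) :
    Tendsto (fun k : ℝ => ∑' n : ℕ, (d n * (k ^ 2 / (μ n + k ^ 2)) +
      w n * (k ^ 2 / (μ n + k ^ 2)) * (((n : ℝ) ^ 2 - μ n) / ((n : ℝ) ^ 2 + k ^ 2))))
      atTop (𝓝 (∑' n, d n)) := by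
  have hbound : Summable fun n : ℕ => |d n| * 2 + 4 * C * (1 / ((n : ℝ) + 1) ^ 2) := by
    refine (hd.mul_right 2).add (Summable.mul_left _ ?_)
    have := (summable_nat_add_iff 1).2 (Real.summable_one_div_nat_pow.2 one_lt_two)
    simpa using this
  refine tendsto_tsum_of_dominated_convergence hbound (fun n => tendsto_regularized_term _ _ _ _) ?_
  filter_upwards [hμk, eventually_ge_atTop 1] with k hk hk1 n
  exact abs_regularized_term_le (hw n) (hw1 n) hC (hb n) (hk n) hk1

/-- Separates the difference of reciprocal norming constants, which survives the limit, from the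
eigenvalue shift, which disappears. -/
theorem regularized_term_eq {a b m N k : ℝ} (ha : a ≠ 0) (hb : b ≠ 0) (hm : m + k ^ 2 ≠ 0)
    (hN : N + k ^ 2 ≠ 0) :
    k ^ 2 * (1 / (a * (m + k ^ 2)) - 1 / (b * (N + k ^ 2))) =
      (1 / a - 1 / b) * (k ^ 2 / (m + k ^ 2)) +
        1 / b * (k ^ 2 / (m + k ^ 2)) * ((N - m) / (N + k ^ 2)) := by
  field_simp
  ring

/-- The difference of the two Green functions times k² has the limit -h from its closed form and the
limit ∑ (1/a_n - w_n) from its series; limits are unique. -/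
theorem hasSum_of_hasSum_green {a b w μ : ℕ → ℝ} {ε ε₀ : ℝ → ℝ} {h C : ℝ}
    (ha : ∀ n, a n ≠ 0) (hb : ∀ n, b n ≠ 0) (hbw : ∀ n, 1 / b n = w n)
    (hw : ∀ n, 0 ≤ w n) (hw1 : ∀ n, w n ≤ 1)
    (hε : Tendsto ε atTop (𝓝 0)) (hε₀ : Tendsto ε₀ atTop (𝓝 0))
    (hG : ∀ᶠ k : ℝ in atTop, HasSum (fun n => 1 / (a n * (μ n + k ^ 2))) (1 / (h + k + ε k)))
    (hG₀ : ∀ᶠ k : ℝ in atTop, HasSum (fun n : ℕ => 1 / (b n * ((n : ℝ) ^ 2 + k ^ 2)))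
      (1 / (0 + k + ε₀ k)))
    (hC : 0 ≤ C) (hμ : ∀ n : ℕ, |μ n - (n : ℝ) ^ 2| ≤ C) (hμm : Monotone μ)
    (hsum : Summable fun n => |1 / a n - w n|) : HasSum (fun n => 1 / a n - w n) (-h) := by
  have hμk : ∀ᶠ k : ℝ in atTop, ∀ n, k ^ 2 / 2 ≤ μ n + k ^ 2 := by
    filter_upwards [eventually_ge_atTop (1 + 2 * |μ 0|)] with k hk n
    have h2 := hμm (Nat.zero_le n)
    have h3 := neg_abs_le (μ 0)
    nlinarith [abs_nonneg (μ 0)]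
  have hlim := tendsto_tsum_regularized hsum hw hw1 hC hμ hμk
  have heq : ∀ᶠ k : ℝ in atTop, k ^ 2 * (1 / (h + k + ε k) - 1 / (0 + k + ε₀ k)) =
      ∑' n : ℕ, ((1 / a n - w n) * (k ^ 2 / (μ n + k ^ 2)) + w n *
        (k ^ 2 / (μ n + k ^ 2)) * (((n : ℝ) ^ 2 - μ n) / ((n : ℝ) ^ 2 + k ^ 2))) := by
    filter_upwards [hG, hG₀, hμk, eventually_ge_atTop (1 : ℝ)] with k h1 h2 h3 hk
    rw [← ((h1.sub h2).mul_left (k ^ 2)).tsum_eq]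
    refine tsum_congr fun n => ?_
    have h4 : 0 < μ n + k ^ 2 := by nlinarith [h3 n]
    have h5 : 0 < (n : ℝ) ^ 2 + k ^ 2 := by nlinarith [sq_nonneg (n : ℝ)]
    rw [← hbw n]
    exact regularized_term_eq (ha n) (hb n) h4.ne' h5.ne'
  have hlim2 := (tendsto_green_difference h hε hε₀).congr' heq
  have hs : Summable fun n => 1 / a n - w n := Summable.of_norm hsum
  have he := tendsto_nhds_unique hlim hlim2
  exact he ▸ hs.hasSum

theorem EigenSystem.hasSum_norming {q : ℝ → ℝ} {h H : ℝ} {y z : ℝ → ℝ → ℝ} {μ : ℕ → ℝ}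
    (hq : IntervalIntegrable q volume 0 π) (hs : EigenSystem q h H y z μ)
    (hsum : Summable fun n => |1 / (∫ x in (0 : ℝ)..π, y (μ n) x ^ 2) - freeWeight n|) :
    HasSum (fun n => 1 / (∫ x in (0 : ℝ)..π, y (μ n) x ^ 2) - freeWeight n) (-h) := by
  obtain ⟨ε, hε, hG⟩ := hs.hasSum_green hq
  obtain ⟨y₀, z₀, hs₀, hw⟩ := exists_free_eigenSystem
  obtain ⟨ε₀, hε₀, hG₀⟩ := hs₀.hasSum_green intervalIntegrable_const
  obtain ⟨C, hC, hb⟩ := hs.bounded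
  exact hasSum_of_hasSum_green (fun n => (hs.integral_sq_pos n).ne')
    (fun n => (hs₀.integral_sq_pos n).ne') hw freeWeight_nonneg freeWeight_le_one hε hε₀ hG hG₀
    hC hb hs.strictMono.monotone hsum

/-! ### From complex solutions and chosen objects to the real theory -/

theorem intervalIntegrable_of_memLp {q : ℝ → ℝ} (hq : MemLp q 2 (volume.restrict (Icc 0 π))) :
    IntervalIntegrable q volume 0 π := by
  rw [intervalIntegrable_iff_integrableOn_Icc_of_le pi_pos.le]
  exact hq.integrable one_le_two

theorem memLp_reflect {q : ℝ → ℝ} (hq : MemLp q 2 (volume.restrict (Icc 0 π))) :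
    MemLp (fun x => q (π - x)) 2 (volume.restrict (Icc 0 π)) := by
  have h1 : MeasurePreserving (fun x : ℝ => π - x) volume volume :=
    Measure.measurePreserving_sub_left volume π
  have h2 := h1.restrict_preimage (s := Icc 0 π) measurableSet_Icc
  have h3 : (fun x : ℝ => π - x) ⁻¹' Icc 0 π = Icc 0 π := by simp
  rw [h3] at h2
  exact hq.comp_measurePreserving h2

theorem ACD.of_hasDerivWithinAt {f f' : ℝ → ℝ}
    (h : ∀ x ∈ Icc 0 π, HasDerivWithinAt f (f' x) (Icc 0 π) x)
    (hc : ContinuousOn f' (Icc 0 π)) : ACD f f' := by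
  have hi := intervalIntegrable_of_continuousOn hc
  refine (((ACD.const (f 0)).add (ACD.of_integral hi)).congr_fun fun x hx => ?_).congr_deriv
    fun x _ => by ring
  rw [intervalIntegral.integral_eq_sub_of_hasDerivAt_of_le hx.1
    (fun t ht => ((h t ⟨ht.1, ht.2.trans hx.2⟩).continuousWithinAt).mono
      (Icc_subset_Icc_right hx.2))
    (fun t ht => (h t ⟨ht.1.le, ht.2.le.trans hx.2⟩).hasDerivAt
      (Icc_mem_nhds ht.1 (ht.2.trans_le hx.2))) (intervalIntegrable_sub hi hx)]
  ring

theorem ACD.hasDerivWithinAt {f f' : ℝ → ℝ} (hf : ACD f f') (hc : Continuous f') {x : ℝ}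
    (hx : x ∈ Icc 0 π) : HasDerivWithinAt f (f' x) (Icc 0 π) x := by
  have h1 : HasDerivAt (fun x => f 0 + ∫ t in (0 : ℝ)..x, f' t) (f' x) x :=
    (hc.integral_hasStrictDerivAt 0 x).hasDerivAt.const_add (f 0)
  refine h1.hasDerivWithinAt.congr (fun t ht => ?_) ?_
  · rw [hf.integral_eq_sub ht]; ring
  · rw [hf.integral_eq_sub hx]; ring

namespace IsSolution

variable {q : ℝ → ℝ} {μ : ℂ} {y : ℝ → ℂ}

theorem hasDerivWithinAt (h : IsSolution q μ y) {x : ℝ} (hx : x ∈ Icc 0 π) :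
    HasDerivWithinAt y (D y x) (Icc 0 π) x :=
  (h.differentiableOn x hx).hasDerivWithinAt

/-- A real-linear functional `L` treats real and imaginary parts at once. -/
theorem acd_snd (h : IsSolution q μ y) (L : ℂ →L[ℝ] ℝ) :
    ACD (fun x => L (D y x)) fun x => L (((q x : ℂ) - μ) * y x) := by
  refine ⟨absolutelyContinuousOnInterval_lipschitz_comp (L.lipschitz.lipschitzOnWith (s := univ))
    h.absolutelyContinuous fun _ _ => mem_univ _, ?_⟩
  have h0 : ∀ᵐ x : ℝ, x ≠ 0 := by simp [ae_iff, measure_singleton]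
  have h1 : ∀ᵐ x : ℝ, x ≠ π := by simp [ae_iff, measure_singleton]
  filter_upwards [(ae_restrict_iff' measurableSet_Ioo).1 h.equation, h0, h1] with x hx hx0 hx1 hx'
  obtain ⟨y'', hd, he⟩ := hx ⟨lt_of_le_of_ne hx'.1 hx0.symm, lt_of_le_of_ne hx'.2 hx1⟩
  have e : ((q x : ℂ) - μ) * y x = y'' := by linear_combination he
  rw [e]
  exact L.hasFDerivAt.comp_hasDerivAt x hd

theorem acd_fst (h : IsSolution q μ y) (L : ℂ →L[ℝ] ℝ) :
    ACD (fun x => L (y x)) fun x => L (D y x) :=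
  ACD.of_hasDerivWithinAt
    (fun x hx => L.hasFDerivAt.comp_hasDerivWithinAt x (h.hasDerivWithinAt hx))
    (h.acd_snd L).continuousOn

theorem realSol {l : ℝ} (h : IsSolution q l y) (L : ℂ →L[ℝ] ℝ) :
    RealSol q l (fun x => L (y x)) fun x => L (D y x) := by
  refine ⟨h.acd_fst L, (h.acd_snd L).congr_deriv fun x _ => ?_⟩
  rw [← smul_eq_mul (a := q x - l), ← L.map_smul, Complex.real_smul]
  push_cast
  rfl

/-- A solution with values in `ℂ` is a multiple of a real solution with proportional data. -/
theorem eq_mul (hq : IntervalIntegrable q volume 0 π) {l : ℝ} {u v : ℝ → ℝ}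
    (hu : RealSol q l u v) (h : IsSolution q l y) {c : ℂ} (h0 : y 0 = c * u 0)
    (h1 : D y 0 = c * v 0) {x : ℝ} (hx : x ∈ Icc 0 π) : y x = c * u x ∧ D y x = c * v x := by
  have key := fun (L : ℂ →L[ℝ] ℝ) (hL : ∀ t : ℝ, L (c * t) = L c * t) =>
    (h.realSol L).unique hq (hu.const_mul (L c)) (by rw [h0, hL]) (by rw [h1, hL]) hx
  have hre := key Complex.reCLM fun t => by simp
  have him := key Complex.imCLM fun t => by simp
  simp only [Complex.reCLM_apply, Complex.imCLM_apply] at hre him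
  exact ⟨Complex.ext (by simp [hre.1]) (by simp [him.1]),
    Complex.ext (by simp [hre.2]) (by simp [him.2])⟩

theorem eq_mul_right (hq : IntervalIntegrable q volume 0 π) {l : ℝ} {u v : ℝ → ℝ}
    (hu : RealSol q l u v) (h : IsSolution q l y) {c : ℂ} (h0 : y π = c * u π)
    (h1 : D y π = c * v π) {x : ℝ} (hx : x ∈ Icc 0 π) : y x = c * u x := by
  have key := fun (L : ℂ →L[ℝ] ℝ) (hL : ∀ t : ℝ, L (c * t) = L c * t) =>
    ((h.realSol L).reflect.unique (intervalIntegrable_reflect hq) (hu.const_mul (L c)).reflect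
      (by simp only [sub_zero]; rw [h0, hL]) (by simp only [sub_zero]; rw [h1, hL])
      (pi_sub_mem hx)).1
  have hre := key Complex.reCLM fun t => by simp
  have him := key Complex.imCLM fun t => by simp
  simp only [Complex.reCLM_apply, Complex.imCLM_apply, sub_sub_cancel] at hre him
  exact Complex.ext (by simp [hre]) (by simp [him])

end IsSolution

theorem RealSol.D_mul {q y z : ℝ → ℝ} {l : ℝ} (h : RealSol q l y z) (hz : Continuous z) (c : ℂ)
    {x : ℝ} (hx : x ∈ Icc 0 π) :
    HasDerivWithinAt (fun x => c * (y x : ℂ)) (c * z x) (Icc 0 π) x :=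
  ((h.fst.hasDerivWithinAt hz hx).ofReal_comp).const_mul c

theorem RealSol.D_eq {q y z : ℝ → ℝ} {l : ℝ} (h : RealSol q l y z) (hz : Continuous z) (c : ℂ)
    {x : ℝ} (hx : x ∈ Icc 0 π) : D (fun x => c * (y x : ℂ)) x = c * z x :=
  (h.D_mul hz c hx).derivWithin (uniqueDiffOn_Icc pi_pos x hx)

theorem RealSol.isSolution {q y z : ℝ → ℝ} {l : ℝ} (h : RealSol q l y z) (hz : Continuous z)
    (c : ℂ) : IsSolution q l fun x => c * (y x : ℂ) := by
  refine ⟨fun x hx => (h.D_mul hz c hx).differentiableWithinAt, ?_, ?_⟩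
  · have hF : LipschitzOnWith ‖c‖₊ (fun t : ℝ => c * (t : ℂ)) univ :=
      LipschitzWith.lipschitzOnWith (LipschitzWith.of_dist_le_mul fun s t => by
        rw [Complex.dist_eq, ← mul_sub, norm_mul, ← Complex.ofReal_sub, Complex.norm_real,
          Real.dist_eq, Real.norm_eq_abs, coe_nnnorm])
    refine absolutelyContinuousOnInterval_congr
      (absolutelyContinuousOnInterval_lipschitz_comp hF h.snd.ac fun _ _ => mem_univ _)
      fun x hx => ?_
    rw [uIcc_zero_pi] at hx
    rw [h.D_eq hz c hx]
  · rw [ae_restrict_iff' measurableSet_Ioo]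
    filter_upwards [h.snd.hasDerivAt_ae] with x hx hx'
    refine ⟨c * ((q x - l) * y x : ℝ), ?_, by push_cast; ring⟩
    refine ((hx (Ioo_subset_Icc_self hx')).ofReal_comp.const_mul c).congr_of_eventuallyEq ?_
    filter_upwards [Icc_mem_nhds hx'.1 hx'.2] with t ht using h.D_eq hz c ht

theorem eq_cot_mul {θ : ℝ} (hθ : θ ∈ Ioo 0 π) {a b : ℂ}
    (h : a * (cos θ : ℂ) + b * (sin θ : ℂ) = 0) : b = ((-cot θ : ℝ) : ℂ) * a := by
  have hs : (sin θ : ℂ) ≠ 0 := by exact_mod_cast (sin_pos_of_mem_Ioo hθ).ne'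
  rw [Real.cot_eq_cos_div_sin]
  push_cast at hs h ⊢
  field_simp
  linear_combination h

theorem add_eq_zero_of_eq_cot_mul {θ : ℝ} (hθ : θ ∈ Ioo 0 π) {a b : ℂ}
    (h : b = ((-cot θ : ℝ) : ℂ) * a) : a * (cos θ : ℂ) + b * (sin θ : ℂ) = 0 := by
  have hs : (sin θ : ℂ) ≠ 0 := by exact_mod_cast (sin_pos_of_mem_Ioo hθ).ne'
  rw [h, Real.cot_eq_cos_div_sin]
  push_cast at hs ⊢
  field_simp
  ring

/-- The Wronskian of Re y and Im y vanishes at both ends because the boundary conditions are real,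
while its derivative is -Im μ · |y|². -/
theorem IsEigenvalue.im_eq_zero {q : ℝ → ℝ} {α β : ℝ} (hα : α ∈ Ioo 0 π) (hβ : β ∈ Ioo 0 π)
    {μ : ℂ} (h : IsEigenvalue q α β μ) : μ.im = 0 := by
  obtain ⟨y, hy, ⟨x, hx, hne⟩, h0, h1⟩ := h
  have e0 := eq_cot_mul hα h0
  have e1 := eq_cot_mul hβ h1
  have hre := hy.acd_fst Complex.reCLM
  have him := hy.acd_fst Complex.imCLM
  have hre' := hy.acd_snd Complex.reCLM
  have him' := hy.acd_snd Complex.imCLM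
  have hW := ((hre.mul him').sub (him.mul hre')).congr_deriv
    (g' := fun x => -μ.im * ((y x).re ^ 2 + (y x).im ^ 2)) fun x _ => by
      simp
      ring
  have hi := hW.integral_eq_sub pi_mem
  simp only [Complex.reCLM_apply, Complex.imCLM_apply, e0, e1, Complex.re_ofReal_mul,
    Complex.im_ofReal_mul] at hi
  rw [intervalIntegral.integral_const_mul] at hi
  have hpos : 0 < ∫ x in (0 : ℝ)..π, ((y x).re ^ 2 + (y x).im ^ 2) := by
    refine intervalIntegral.integral_pos pi_pos
      ((hre.continuousOn.pow 2).add (him.continuousOn.pow 2)) (fun t _ => by positivity)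
      ⟨x, hx, ?_⟩
    rcases eq_or_ne (y x).re 0 with h | h
    · have : (y x).im ≠ 0 := fun h' => hne (Complex.ext h h')
      positivity
    · positivity
  have hz : -μ.im * ∫ x in (0 : ℝ)..π, ((y x).re ^ 2 + (y x).im ^ 2) = 0 := by
    rw [hi]
    ring
  simpa [hpos.ne'] using hz

theorem SolFamily.isEigenvalue_iff {q : ℝ → ℝ} {α β : ℝ} {y z : ℝ → ℝ → ℝ}
    (hq : IntervalIntegrable q volume 0 π) (hα : α ∈ Ioo 0 π) (hβ : β ∈ Ioo 0 π)
    (hy : SolFamily q (-cot α) y z) (l : ℝ) :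
    IsEigenvalue q α β l ↔ z l π + cot β * y l π = 0 := by
  constructor
  · rintro ⟨Y, hY, ⟨x, hx, hne⟩, h0, h1⟩
    have e0 := eq_cot_mul hα h0
    have e1 := eq_cot_mul hβ h1
    have key := fun {x : ℝ} (hx : x ∈ Icc 0 π) => hY.eq_mul hq (hy.sol l) (c := Y 0)
      (by simp [hy.fst_zero]) (by rw [e0, hy.snd_zero]; push_cast; ring) hx
    have hc : Y 0 ≠ 0 := fun h => hne (by rw [(key hx).1, h, zero_mul])
    rw [(key pi_mem).1, (key pi_mem).2] at e1
    have : Y 0 * ((z l π + cot β * y l π : ℝ) : ℂ) = 0 := by push_cast at e1 ⊢; linear_combination e1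
    exact_mod_cast (mul_eq_zero.1 this).resolve_left hc
  · intro h
    refine ⟨_, (hy.sol l).isSolution (hy.snd_cont l) 1, ⟨0, zero_mem, by simp [hy.fst_zero]⟩,
      add_eq_zero_of_eq_cot_mul hα ?_, add_eq_zero_of_eq_cot_mul hβ ?_⟩
    · rw [(hy.sol l).D_eq (hy.snd_cont l) 1 zero_mem, hy.fst_zero, hy.snd_zero]
      push_cast; ring
    · rw [(hy.sol l).D_eq (hy.snd_cont l) 1 pi_mem]
      have : z l π = -cot β * y l π := by linear_combination h
      rw [this]
      push_cast; ring

theorem IsEigenvalueSequence.eigenvalue_eq {q : ℝ → ℝ} {α β : ℝ} {μ : ℕ → ℝ}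
    (h : IsEigenvalueSequence q α β μ) : eigenvalue q α β = μ := by
  have h' : IsEigenvalueSequence q α β (eigenvalue q α β) := Classical.epsilon_spec ⟨μ, h⟩
  refine (StrictMono.range_inj h'.1 h.1).1 (Set.ext fun l => ?_)
  have := (h'.2 l).symm.trans (h.2 l)
  simpa using this

/-- Existence shows that the chosen `phi` is a genuine solution, and uniqueness identifies it on [0,
π], the only place where its values are determined. -/
theorem SolFamily.phiTilde_eq {q : ℝ → ℝ} {α : ℝ} {y z : ℝ → ℝ → ℝ}
    (hq : IntervalIntegrable q volume 0 π) (hα : α ∈ Ioo 0 π) (hy : SolFamily q (-cot α) y z)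
    (l : ℝ) {x : ℝ} (hx : x ∈ Icc 0 π) : phiTilde q α l x = y l x := by
  have hs : (sin α : ℂ) ≠ 0 := by exact_mod_cast (sin_pos_of_mem_Ioo hα).ne'
  have hc : (-cos α : ℂ) = sin α * z l 0 := by
    rw [hy.snd_zero, Real.cot_eq_cos_div_sin]
    push_cast at hs ⊢
    field_simp
  have h : IsSolution q l (phi q α l) ∧ phi q α l 0 = sin α ∧ D (phi q α l) 0 = -(cos α : ℂ) :=
    Classical.epsilon_spec (p := fun y : ℝ → ℂ => IsSolution q l y ∧ y 0 = (sin α : ℂ) ∧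
      D y 0 = -(cos α : ℂ)) ⟨_, (hy.sol l).isSolution (hy.snd_cont l) (sin α),
        by simp [hy.fst_zero], by rw [(hy.sol l).D_eq (hy.snd_cont l) _ zero_mem, hc]⟩
  rw [phiTilde, (h.1.eq_mul hq (hy.sol l) (c := sin α) (by rw [h.2.1, hy.fst_zero]; simp)
    (by rw [h.2.2, hc]) hx).1]
  field_simp

/-- The normalized slope at π is -cot β; reflection reverses its sign, hence the family with slope
cot β at 0. -/
theorem SolFamily.psiTilde_eq {q : ℝ → ℝ} {β : ℝ} {y z : ℝ → ℝ → ℝ}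
    (hq : IntervalIntegrable q volume 0 π) (hβ : β ∈ Ioo 0 π)
    (hy : SolFamily (fun x => q (π - x)) (cot β) y z)
    (l : ℝ) {x : ℝ} (hx : x ∈ Icc 0 π) : psiTilde q β l x = y l (π - x) := by
  have hs : (sin β : ℂ) ≠ 0 := by exact_mod_cast (sin_pos_of_mem_Ioo hβ).ne'
  have hsol : RealSol q l (fun x => y l (π - x)) fun x => -z l (π - x) := by
    simpa using (hy.sol l).reflect
  have hcont : Continuous fun x => -z l (π - x) :=
    ((hy.snd_cont l).comp (continuous_const.sub continuous_id)).neg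
  have hc : (-cos β : ℂ) = sin β * (-z l (π - π) : ℝ) := by
    rw [sub_self, hy.snd_zero, Real.cot_eq_cos_div_sin]
    push_cast at hs ⊢
    field_simp
  have h : IsSolution q l (psi q β l) ∧ psi q β l π = sin β ∧ D (psi q β l) π = -(cos β : ℂ) :=
    Classical.epsilon_spec (p := fun y : ℝ → ℂ => IsSolution q l y ∧ y π = (sin β : ℂ) ∧
      D y π = -(cos β : ℂ)) ⟨_, hsol.isSolution hcont (sin β),
        by simp [hy.fst_zero], by rw [hsol.D_eq hcont _ pi_mem, hc]⟩
  rw [psiTilde, h.1.eq_mul_right hq hsol (c := sin β)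
    (by rw [h.2.1, sub_self, hy.fst_zero]; simp)
    (by rw [h.2.2, hc]) hx]
  field_simp

theorem tendsto_sum_of_hasSum_sub_freeWeight {a : ℕ → ℝ} {s : ℝ}
    (h : HasSum (fun n => 1 / a n - freeWeight n) s) :
    Tendsto (fun N : ℕ => 1 / a 0 - 1 / π + ∑ n ∈ Finset.Icc 1 N, (1 / a n - 2 / π))
      atTop (𝓝 s) := by
  -- Partial sums over the first N + 1 indices split into the term 0, with weight 1/π, and the terms
  -- 1 to N.
  refine (h.tendsto_sum_nat.comp (tendsto_add_atTop_nat 1)).congr fun N => ?_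
  have e : Finset.Ico 1 (N + 1) = Finset.Icc 1 N := by ext; simp
  rw [Function.comp_apply, Finset.range_eq_Ico,
    Finset.sum_eq_sum_Ico_succ_bot (Nat.succ_pos N), zero_add, e]
  refine congrArg₂ (· + ·) (by simp [freeWeight]) ?_
  refine Finset.sum_congr rfl fun n hn => ?_
  rw [freeWeight, if_neg (by have := (Finset.mem_Icc.1 hn).1; omega)]

/-- The characteristic functions built from the left and the right end coincide. -/
theorem SolFamily.characteristic_reflect {q : ℝ → ℝ} {h H : ℝ} {y z y' z' : ℝ → ℝ → ℝ}
    (hy : SolFamily q h y z) (hy' : SolFamily (fun x => q (π - x)) H y' z') (l : ℝ) :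
    z' l π + h * y' l π = z l π + H * y l π := by
  have hsol : RealSol q l (fun x => y' l (π - x)) fun x => -z' l (π - x) := by
    simpa using (hy'.sol l).reflect
  have := (hy.sol l).integral_mul hsol
  simp only [sub_self, zero_mul, sub_zero, hy.fst_zero, hy.snd_zero, hy'.fst_zero,
    hy'.snd_zero] at this
  linear_combination -this

end SturmLiouville

theorem theorem1p2 (q : ℝ → ℝ) (hq : MemLp q 2 (volume.restrict (Icc 0 Real.pi)))
    (α β : ℝ) (hα : α ∈ Ioo 0 Real.pi) (hβ : β ∈ Ioo 0 Real.pi) :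
    Tendsto (fun N : ℕ => 1 / SturmLiouville.aTilde q α β 0 - 1 / Real.pi +
        ∑ n ∈ Finset.Icc 1 N, (1 / SturmLiouville.aTilde q α β n - 2 / Real.pi))
      atTop (𝓝 (Real.cot α)) ∧
    Tendsto (fun N : ℕ => 1 / SturmLiouville.bTilde q α β 0 - 1 / Real.pi +
        ∑ n ∈ Finset.Icc 1 N, (1 / SturmLiouville.bTilde q α β n - 2 / Real.pi))
      atTop (𝓝 (-Real.cot β)) := by
  open SturmLiouville in
  have hqi := intervalIntegrable_of_memLp hq
  have hqi' := intervalIntegrable_reflect hqi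
  obtain ⟨y, z, hy⟩ := SolFamily.exists hqi (-Real.cot α)
  obtain ⟨y', z', hy'⟩ := SolFamily.exists hqi' (Real.cot β)
  obtain ⟨μ, hμm, hμ, N₀, hloc⟩ := hy.exists_eigenvalues hqi (Real.cot β)
  have hμ0 : ∀ n, z (μ n) Real.pi + Real.cot β * y (μ n) Real.pi = 0 :=
    fun n => (hμ _).2 ⟨n, rfl⟩
  have heig : eigenvalue q α β = μ := by
    refine IsEigenvalueSequence.eigenvalue_eq ⟨hμm, fun w => ⟨fun hw => ?_, ?_⟩⟩
    · have hre : w = (w.re : ℂ) := Complex.ext rfl (by simp [hw.im_eq_zero hα hβ])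
      rw [hre] at hw ⊢
      obtain ⟨n, hn⟩ := (hμ _).1 ((hy.isEigenvalue_iff hqi hα hβ _).1 hw)
      exact ⟨n, by rw [hn]⟩
    · rintro ⟨n, rfl⟩
      exact (hy.isEigenvalue_iff hqi hα hβ _).2 (hμ0 n)
  have ha : ∀ n, aTilde q α β n = ∫ x in (0 : ℝ)..Real.pi, y (μ n) x ^ 2 := by
    intro n
    rw [aTilde, heig]
    refine intervalIntegral.integral_congr fun x hx => ?_
    rw [uIcc_zero_pi] at hx
    simp [hy.phiTilde_eq hqi hα _ hx]
  have hb : ∀ n, bTilde q α β n = ∫ x in (0 : ℝ)..Real.pi, y' (μ n) x ^ 2 := by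
    intro n
    have h1 := intervalIntegral.integral_comp_sub_left (a := 0) (b := Real.pi)
      (fun x => y' (μ n) x ^ 2) Real.pi
    rw [sub_self, sub_zero] at h1
    rw [bTilde, heig, ← h1]
    refine intervalIntegral.integral_congr fun x hx => ?_
    rw [uIcc_zero_pi] at hx
    simp [hy'.psiTilde_eq hqi hβ _ hx]
  obtain ⟨hs, hsum⟩ := hy.eigenSystem hq hqi hμm hμ0 hloc
  -- Under reflection the condition at 0 becomes one at π with constant -cot α, and the same numbers
  -- `μ n` are eigenvalues because the characteristic functions agree.
  obtain ⟨hs', hsum'⟩ := hy'.eigenSystem (H := -Real.cot α) (memLp_reflect hq) hqi' hμm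
    (fun n => by rw [hy.characteristic_reflect hy', hμ0]) hloc
  constructor
  · have := tendsto_sum_of_hasSum_sub_freeWeight (hs.hasSum_norming hqi hsum)
    simpa only [ha, neg_neg] using this
  · have := tendsto_sum_of_hasSum_sub_freeWeight (hs'.hasSum_norming hqi' hsum')
    simpa only [hb] using this
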